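/- Let $\mathbb F_q\subseteq\mathbb F_{q^m}$ be finite fields and write $[i]:=q^i$. Let $\mathcal L$ be the set of $q$-linearized polynomials $f(x)=\sum_i a_i x^{[i]}$ over $\mathbb F_{q^m}$, a ring under $+$ and composition $\circ$; $\mathrm{qdeg}(f)$ is the largest $i$ with $a_i\ne0$, and $\mathrm{qdeg}(0)=-\infty$. Let $k\ge1$, let $g_1,\dots,g_n\in\mathbb F_{q^m}$ be linearly independent over $\mathbb F_q$, and let $C\subseteq\mathbb F_{q^m}^n$ be the $\mathbb F_{q^m}$-row space of the $k\times n$ Moore matrix $(g_j^{[i]})_{0\le i<k,\,1\le j\le n}$ (the Gabidulin code). A message polynomial is an $f\in\mathcal L$ with $\mathrm{qdeg}(f)<k$; its codeword is $\mathbf c_f=(f(g_1),\dots,f(g_n))\in C$. The rank distance $d_R(\mathbf u,\mathbf v)$ is the rank over $\mathbb F_q$ of the $m\times n$ matrix obtained from $\mathbf u-\mathbf v$ by expanding its entries in an $\mathbb F_q$-basis of $\mathbb F_{q^m}$. Let $\mathbf r=(r_1,\dots,r_n)\in\mathbb F_{q^m}^n$. Put $\Pi(x)=\prod_{\alpha\in\langle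 g_1,\dots,g_n\rangle_{\mathbb F_q}}(x-\alpha)$ and let $\Lambda(x)=\sum_{i=1}^n(-1)^{n-i}r_i\det(\mathfrak D_i(x))/\det(M_n(g_1,\dots,g_n))$ be the $q$-Lagrange polynomial, where $M_n(v_1,\dots,v_l)=(v_j^{[i]})_{0\le i<n,\,1\le j\le l}$ and $\mathfrak D_i(x)$ is $M_n(g_1,\dots,g_n,x)$ without its $i$-th column. The interpolation module $\mathfrak M(\mathbf r)$ is the left $\mathcal L$-span (under $\circ$) of the rows $[\Pi\;\;0]$ and $[-\Lambda\;\;x]$. The weighted degree of $f=[f^{(1)}\;f^{(2)}]$ is $\max\{\mathrm{qdeg} f^{(1)},\,k-1+\mathrm{qdeg} f^{(2)}\}$. Order the monomials $x^{[i]}e_p$ ($p=1,2$) by weighted degree, the one in position $2$ being larger in a tie; $x^{[i]}e_p$ divides $x^{[j]}e_{p'}$ if $p=p'$ and $i\le j$. A minimal Gröbner basis of $\mathfrak M(\mathbf r)$ is a set of nonzero elements of $\mathfrak M(\mathbf r)$ such that the leading monomial of every nonzero element of $\mathfrak M(\mathbf r)$ is divisible by the leading monomial of some basis element, and no leading monomial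 of a basis element divides that of another one. **Theorem.** There is a minimal Gröbner basis $\{g_1(x),g_2(x)\}$ of $\mathfrak M(\mathbf r)$ with $\mathrm{qdeg}(g_2^{(1)})\le\mathrm{qdeg}(g_2^{(2)})+k-1$. Given any such basis, let $\ell_1,\ell_2$ be the weighted degrees of $g_1(x),g_2(x)$, and run the following algorithm. For $j=0,1,2,\dots$: for all $a\in\mathcal L$ with $\mathrm{qdeg}(a)\le\ell_2-\ell_1+j$ and all monic $b\in\mathcal L$ with $\mathrm{qdeg}(b)=j$, form $f=a\circ g_1+b\circ g_2$ and write $f=[N\;\;-D]$; if $N=D\circ s$ for some $s\in\mathcal L$, add $s$ to the list. Stop after the first $j$ for which the list is nonempty, and return the list. Then the algorithm terminates, and the polynomials in the returned list are exactly the message polynomials $f$ whose codeword $\mathbf c_f$ is closest to $\mathbf r$, that is, $d_R(\mathbf c_f,\mathbf r)=\min_{\mathbf c\in C}d_R(\mathbf c,\mathbf r)$. -/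

import Mathlib

open Polynomial

namespace RankList

section Linearized

variable {K : Type*} [Field K]

/-- A `q`-linearized polynomial: one of the form `∑ a_i x^(q^i)`. -/
def IsLinearized (q : ℕ) (f : K[X]) : Prop :=
  ∀ d ∈ f.support, ∃ i : ℕ, d = q ^ i

open Classical in
/-- The `q`-degree of a `q`-linearized polynomial (`⊥` for the zero polynomial): the `i` with
`deg f = q^i`. -/
noncomputable def qdeg (q : ℕ) (f : K[X]) : WithBot ℕ :=
  if f = 0 then ⊥ else ((Nat.log q f.natDegree : ℕ) : WithBot ℕ)

/-- The `k × n` Moore matrix of `v`, with `(i, j)` entry `v_j^(q^i)`. -/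
def mooreMatrix {R : Type*} [CommRing R] (q k : ℕ) {n : ℕ} (v : Fin n → R) :
    Matrix (Fin k) (Fin n) R :=
  Matrix.of fun i j => v j ^ q ^ (i : ℕ)

/-- The Gabidulin code: the row space over `K` of the Moore matrix `M_k(g_1, …, g_n)`. -/
def gabidulinCode (q k : ℕ) {n : ℕ} (g : Fin n → K) : Submodule K (Fin n → K) :=
  Submodule.span K (Set.range fun i : Fin k => (mooreMatrix q k g) i)

/-- The word `(f(g_1), …, f(g_n))` of the message polynomial `f`. -/
noncomputable def encode {n : ℕ} (g : Fin n → K) (f : K[X]) : Fin n → K :=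
  fun i => f.eval (g i)

/-- The rank distance of two words over `K`, seen as `m × n` matrices over `F` by expanding every
coordinate in the basis `β`. -/
noncomputable def rankDist {F : Type*} [Field F] [Algebra F K] {m n : ℕ}
    (β : Module.Basis (Fin m) F K) (u v : Fin n → K) : ℕ :=
  (β.toMatrix (u - v)).rank

/-- `f` is a message polynomial (a `q`-linearized polynomial of `q`-degree `< k`) whose codeword
has minimal rank distance to `r` among all codewords. -/
def IsClosestMessage {F : Type*} [Field F] [Algebra F K] (q k : ℕ) {m n : ℕ}
    (β : Module.Basis (Fin m) F K) (g r : Fin n → K) (f : K[X]) : Prop :=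
  IsLinearized q f ∧ qdeg q f < (k : WithBot ℕ) ∧
    ∀ c ∈ gabidulinCode q k g, rankDist β (encode g f) r ≤ rankDist β c r

end Linearized

section InterpolationModule

variable {K : Type*} [Field K]

open Classical in
/-- `Π(x) = ∏_{α ∈ ⟨g_1, …, g_n⟩} (x - α)`, the product over the `F`-span of the `g_i`. -/
noncomputable def annihilatorPoly (F : Type*) [Field F] [Algebra F K] [Fintype K] {n : ℕ}
    (g : Fin n → K) : K[X] :=
  ∏ α ∈ Finset.univ.filter (fun α : K => α ∈ Submodule.span F (Set.range g)), (X - C α)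

/-- The matrix `M_n(g_1, …, g_n, x)` without its `i`-th column. -/
noncomputable def lagrangeMinor (q : ℕ) {n : ℕ} (g : Fin n → K) (i : Fin n) :
    Matrix (Fin n) (Fin n) K[X] :=
  (mooreMatrix q n (Fin.snoc (α := fun _ => K[X]) (fun l => C (g l)) X)).submatrix id
    i.castSucc.succAbove

/-- The `q`-Lagrange polynomial
`∑_i (-1)^(n-i) r_i det(𝔇_i(g, x)) / det(M_n(g))`, where `i` runs from `1` to `n`; it is written
`(i : ℕ) + 1` for `i : Fin n`. -/
noncomputable def lagrangePoly (q : ℕ) {n : ℕ} (g r : Fin n → K) : K[X] :=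
  ∑ i : Fin n, (-1) ^ (n - ((i : ℕ) + 1)) *
    C (r i * ((mooreMatrix q n g).det)⁻¹) * (lagrangeMinor q g i).det

/-- `a ∘ [f^(1)  f^(2)] = [a ∘ f^(1)  a ∘ f^(2)]`. -/
noncomputable def compRow (a : K[X]) (f : Fin 2 → K[X]) : Fin 2 → K[X] :=
  fun p => a.comp (f p)

/-- The interpolation module: the left row span, over the `q`-linearized polynomials with
composition, of the rows `[Π  0]` and `[-Λ  x]`. -/
def interpolationModule (F : Type*) [Field F] [Algebra F K] [Fintype K] (q : ℕ) {n : ℕ}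
    (g r : Fin n → K) : Set (Fin 2 → K[X]) :=
  {f | ∃ a b : K[X], IsLinearized q a ∧ IsLinearized q b ∧
    f = compRow a ![annihilatorPoly F g, 0] + compRow b ![-lagrangePoly q g r, X]}

end InterpolationModule

section Groebner

variable {K : Type*} [Field K]

/-- The `(w_1, w_2)`-weighted `q`-degree `max {w_1 + qdeg f^(1), w_2 + qdeg f^(2)}`. -/
noncomputable def weightedDeg (q : ℕ) (w : Fin 2 → ℕ) (f : Fin 2 → K[X]) : WithBot ℕ :=
  max (((w 0 : ℕ) : WithBot ℕ) + qdeg q (f 0)) (((w 1 : ℕ) : WithBot ℕ) + qdeg q (f 1))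

/-- The weighted term-over-position order on the monomials `x^(q^i) e_p`, coded by the pairs
`(i, p)`: compare weighted degrees first; on a tie the second position is the larger one. -/
def monomialLE (w : Fin 2 → ℕ) (μ ν : ℕ × Fin 2) : Prop :=
  w μ.2 + μ.1 < w ν.2 + ν.1 ∨ (w μ.2 + μ.1 = w ν.2 + ν.1 ∧ μ.2 ≤ ν.2)

/-- `μ` is the leading monomial of `f`. -/
def IsLeadingMonomial (q : ℕ) (w : Fin 2 → ℕ) (f : Fin 2 → K[X]) (μ : ℕ × Fin 2) : Prop :=
  (f μ.2).coeff (q ^ μ.1) ≠ 0 ∧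
    ∀ ν : ℕ × Fin 2, (f ν.2).coeff (q ^ ν.1) ≠ 0 → monomialLE w ν μ

/-- Divisibility of monomials: `x^(q^j) e_p` is `x^(q^(j-i)) ∘ x^(q^i) e_p` for `i ≤ j`. -/
def monomialDvd (μ ν : ℕ × Fin 2) : Prop :=
  μ.2 = ν.2 ∧ μ.1 ≤ ν.1

/-- Gröbner basis: a subset of the module, without the zero element, such that the leading monomial
of every nonzero element of the module is divisible by the leading monomial of a basis element. -/
def IsGroebnerBasis (q : ℕ) (w : Fin 2 → ℕ) (M G : Set (Fin 2 → K[X])) : Prop :=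
  G ⊆ M ∧ (∀ g ∈ G, g ≠ 0) ∧
    ∀ f ∈ M, f ≠ 0 → ∃ g ∈ G, ∃ μ ν : ℕ × Fin 2,
      IsLeadingMonomial q w g μ ∧ IsLeadingMonomial q w f ν ∧ monomialDvd μ ν

/-- Minimal Gröbner basis: no leading monomial of a basis element divides that of another one. -/
def IsMinimalGroebnerBasis (q : ℕ) (w : Fin 2 → ℕ) (M G : Set (Fin 2 → K[X])) : Prop :=
  IsGroebnerBasis q w M G ∧
    ∀ g ∈ G, ∀ h ∈ G, g ≠ h → ∀ μ ν : ℕ × Fin 2,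
      IsLeadingMonomial q w g μ → IsLeadingMonomial q w h ν → ¬ monomialDvd μ ν

/-- A possible result `(g_1, g_2)` of the basis computation: `{g_1, g_2}` is a minimal Gröbner
basis for the weights `(0, k-1)`, and `qdeg g_2^(1) ≤ qdeg g_2^(2) + k - 1`. -/
def IsAdmissibleBasis (q k : ℕ) (M : Set (Fin 2 → K[X])) (g₁ g₂ : Fin 2 → K[X]) : Prop :=
  IsMinimalGroebnerBasis q ![0, k - 1] M {g₁, g₂} ∧
    qdeg q (g₂ 0) ≤ qdeg q (g₂ 1) + ((k - 1 : ℕ) : WithBot ℕ)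

end Groebner

section Algorithm

variable {K : Type*} [Field K]

open Classical in
/-- The elements of a finite set in some order (used for finite sets only). -/
noncomputable def listOf {α : Type*} (S : Set α) : List α :=
  if h : S.Finite then h.toFinset.toList else []

open Classical in
/-- The symbolic quotient of `N` by `D`, if it exists: the `q`-linearized `s` with `D ∘ s = N`. -/
noncomputable def symbolicQuotient (q : ℕ) (N D : K[X]) : Option K[X] :=
  if h : ∃ s : K[X], IsLinearized q s ∧ D.comp s = N then some h.choose else none

/-- The range of the outer `for` loop: all `a` with `qdeg a ≤ ℓ₂ - ℓ₁ + j`. Here `ℓ₁ ≠ ⊥`; if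
`ℓ₂ - ℓ₁ + j` is negative, then only `a = 0` qualifies. -/
def outerRange (q : ℕ) (ℓ₁ ℓ₂ : WithBot ℕ) (j : ℕ) : Set K[X] :=
  {a | IsLinearized q a ∧ qdeg q a + ℓ₁ ≤ ℓ₂ + (j : WithBot ℕ)}

/-- The range of the inner `for` loop: all monic `b` with `qdeg b = j`. -/
def innerRange (q j : ℕ) : Set K[X] :=
  {b | IsLinearized q b ∧ b.Monic ∧ qdeg q b = (j : WithBot ℕ)}

theorem finite_of_qdeg_lt [Finite K] {q : ℕ} (hq : 2 ≤ q) (d : ℕ) :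
    {a : K[X] | qdeg q a < (d : WithBot ℕ)}.Finite := by
  have hfin : Finite (Polynomial.degreeLT K (q ^ d)) :=
    Finite.of_equiv _ (Polynomial.degreeLTEquiv K (q ^ d)).toEquiv.symm
  refine (Set.toFinite (Polynomial.degreeLT K (q ^ d) : Set K[X])).subset ?_
  intro a ha
  change qdeg q a < (d : WithBot ℕ) at ha
  simp only [qdeg] at ha
  simp only [SetLike.mem_coe, Polynomial.mem_degreeLT]
  split_ifs at ha with h0
  · subst h0
    rw [Polynomial.degree_zero]
    exact WithBot.bot_lt_coe (q ^ d)
  · rw [Polynomial.degree_eq_natDegree h0]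
    have h1 : Nat.log q a.natDegree < d := by exact_mod_cast ha
    exact_mod_cast Nat.lt_pow_of_log_lt (by omega) h1

theorem finite_innerRange [Finite K] {q : ℕ} (hq : 2 ≤ q) (j : ℕ) :
    (innerRange (K := K) q j).Finite := by
  refine (finite_of_qdeg_lt hq (j + 1)).subset ?_
  rintro b ⟨-, -, hb⟩
  change qdeg q b < _
  rw [hb]
  exact_mod_cast Nat.lt_succ_self j

theorem finite_outerRange [Finite K] {q : ℕ} (hq : 2 ≤ q) {ℓ₁ : WithBot ℕ} (h₁ : ℓ₁ ≠ ⊥)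
    (ℓ₂ : WithBot ℕ) (j : ℕ) : (outerRange (K := K) q ℓ₁ ℓ₂ j).Finite := by
  refine (finite_of_qdeg_lt hq (WithBot.unbotD 0 ℓ₂ + j + 1)).subset ?_
  rintro a ⟨-, ha⟩
  change qdeg q a < _
  generalize qdeg q a = x at ha
  induction x with
  | bot => exact WithBot.bot_lt_coe _
  | coe x =>
    induction ℓ₁ with
    | bot => exact absurd rfl h₁
    | coe y =>
      induction ℓ₂ with
      | bot => exact absurd ha (by rw [WithBot.bot_add]; exact not_le_of_gt (WithBot.bot_lt_coe _))
      | coe z =>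
        have h2 : x + y ≤ z + j := WithBot.coe_le_coe.mp ha
        have h3 : x < z + j + 1 := by omega
        exact WithBot.coe_lt_coe.mpr h3

/-- The list of quotients found in the iteration `j`: for every `a` and `b` in the two loops form
`f = a ∘ g₁ + b ∘ g₂`, write `f = [N  -D]`, and keep the symbolic quotient of `N` by `D` if `N` is
divisible by `D` (equivalently, by `f^(2) = -D`). -/
noncomputable def stageList (q : ℕ) (w : Fin 2 → ℕ) (g₁ g₂ : Fin 2 → K[X]) (j : ℕ) :
    List K[X] :=
  (listOf (outerRange (K := K) q (weightedDeg q w g₁) (weightedDeg q w g₂) j)).flatMap fun a =>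
    (listOf (innerRange (K := K) q j)).filterMap fun b =>
      symbolicQuotient q ((compRow a g₁ + compRow b g₂) 0) (-(compRow a g₁ + compRow b g₂) 1)

/-- One turn of the `while` loop on the state `(list, j)`; nothing changes once the loop guard
`list = []` fails. -/
noncomputable def loopStep (q : ℕ) (w : Fin 2 → ℕ) (g₁ g₂ : Fin 2 → K[X]) :
    List K[X] × ℕ → List K[X] × ℕ
  | ([], j) => (stageList q w g₁ g₂ j, j + 1)
  | (x :: l, j) => (x :: l, j)

/-- The algorithm, run on the basis `(g₁, g₂)` from the state `([], 0)`, terminates after finitely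
many turns of the `while` loop and returns the list `out`. -/
def Returns (q k : ℕ) (g₁ g₂ : Fin 2 → K[X]) (out : List K[X]) : Prop :=
  out ≠ [] ∧ ∃ N : ℕ, ((loopStep q ![0, k - 1] g₁ g₂)^[N] ([], 0)).1 = out

end Algorithm

end RankList

/-!
# List decoding of Gabidulin codes by Gröbner bases

Write `q` for the cardinality of `F`. By right division by `Π` and interpolation by `Λ`, the
interpolation module consists of all pairs `[N  -D]` of linearized polynomials with
`N(g_i) = D(r_i)` for all `i` (`mem_interpolationModule_iff`). If `D ≠ 0` and `N = D ∘ s`, the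
condition says that `D` vanishes on the `F`-span of the error word `(s(g_i) - r_i)_i`, whose
dimension is the rank distance of the codeword of `s` from `r`. A nonzero linearized polynomial
of `q`-degree `d` has at most `q^d` roots, and each subspace of dimension at most `d` is annihilated
by one of `q`-degree exactly `d`. So the rank distance is at most `d` exactly if such a `D` of
`q`-degree `d` exists (`rankDist_le_iff`).

For `[D ∘ s  -D]`, having its leading monomial in the second position means `qdeg s < k`, and
the leading monomial is then `x^[qdeg D]`. In an admissible basis the leading monomials of `g₁` and
`g₂` lie in the first and in the second position, say at `i₁` and `i₂`, and both are minimal for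
their position. Division by the basis therefore writes every element of the module as
`a ∘ g₁ + b ∘ g₂` (`exists_eq_compRow_add_compRow`). The leading monomials of the two summands are
in different positions and cannot cancel, so the combination has its leading monomial in the
second position exactly if that of `a ∘ g₁` is below that of `b ∘ g₂`. This is the bound on `qdeg a`
in the algorithm, and it gives `qdeg D = i₂ + qdeg b`. A scalar factor on the left makes `b` monic
and leaves the quotient `s` as it is.

Hence stage `j` finds exactly the message polynomials at rank distance at most `i₂ + j`
(`mem_stageList_iff`). Since no message polynomial has rank distance below `i₂`
(`le_rankDist_encode`), the first nonempty stage is the one at which `i₂ + j` equals the minimal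
distance, and its list consists of the closest message polynomials.
-/

namespace RankList

/-! ### The ring of linearized polynomials -/

section Basic

variable {K : Type*} [Field K] {q : ℕ}

theorem IsLinearized.of_coeff {f : K[X]} (h : ∀ d, f.coeff d ≠ 0 → ∃ i, d = q ^ i) :
    IsLinearized q f := fun d hd => h d (mem_support_iff.mp hd)

theorem isLinearized_iff_mem_span {f : K[X]} :
    IsLinearized q f ↔ f ∈ Submodule.span K (Set.range fun i : ℕ => (X ^ q ^ i : K[X])) := by
  constructor
  · intro h
    rw [f.as_sum_support_C_mul_X_pow]
    refine Submodule.sum_mem _ fun d hd => ?_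
    obtain ⟨i, rfl⟩ := h d hd
    rw [← smul_eq_C_mul]
    exact Submodule.smul_mem _ _ (Submodule.subset_span ⟨i, rfl⟩)
  · intro h
    refine IsLinearized.of_coeff ?_
    induction h using Submodule.span_induction with
    | mem x hx =>
      obtain ⟨i, rfl⟩ := hx
      intro d hd
      refine ⟨i, ?_⟩
      by_contra hne
      exact hd (by simp [coeff_X_pow, hne])
    | zero => intro d hd; simp at hd
    | add x y _ _ hx hy =>
      intro d hd
      by_cases h0 : x.coeff d = 0
      · exact hy d (by simpa [h0] using hd)
      · exact hx d h0
    | smul a x _ hx =>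
      intro d hd
      exact hx d fun h0 => hd (by simp [h0])

theorem isLinearized_zero : IsLinearized q (0 : K[X]) :=
  isLinearized_iff_mem_span.mpr (Submodule.zero_mem _)

theorem IsLinearized.add {f h : K[X]} (hf : IsLinearized q f) (hh : IsLinearized q h) :
    IsLinearized q (f + h) :=
  isLinearized_iff_mem_span.mpr
    (Submodule.add_mem _ (isLinearized_iff_mem_span.mp hf) (isLinearized_iff_mem_span.mp hh))

theorem IsLinearized.neg {f : K[X]} (hf : IsLinearized q f) : IsLinearized q (-f) :=
  isLinearized_iff_mem_span.mpr (Submodule.neg_mem _ (isLinearized_iff_mem_span.mp hf))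

theorem IsLinearized.sub {f h : K[X]} (hf : IsLinearized q f) (hh : IsLinearized q h) :
    IsLinearized q (f - h) := by
  rw [sub_eq_add_neg]; exact hf.add hh.neg

theorem IsLinearized.C_mul {f : K[X]} (hf : IsLinearized q f) (c : K) :
    IsLinearized q (C c * f) := by
  rw [← smul_eq_C_mul]
  exact isLinearized_iff_mem_span.mpr (Submodule.smul_mem _ _ (isLinearized_iff_mem_span.mp hf))

theorem IsLinearized.sum {ι : Type*} {s : Finset ι} {f : ι → K[X]}
    (hf : ∀ i ∈ s, IsLinearized q (f i)) : IsLinearized q (∑ i ∈ s, f i) :=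
  isLinearized_iff_mem_span.mpr
    (Submodule.sum_mem _ fun i hi => isLinearized_iff_mem_span.mp (hf i hi))

theorem isLinearized_X_pow (i : ℕ) : IsLinearized q (X ^ q ^ i : K[X]) :=
  isLinearized_iff_mem_span.mpr (Submodule.subset_span ⟨i, rfl⟩)

theorem isLinearized_C_mul_X_pow (c : K) (i : ℕ) : IsLinearized q (C c * X ^ q ^ i) :=
  (isLinearized_X_pow i).C_mul c

/-- Induction on the shape of a linearized polynomial. -/
theorem IsLinearized.induction {P : K[X] → Prop} {f : K[X]} (hf : IsLinearized q f)
    (monomial : ∀ c i, P (C c * X ^ q ^ i)) (zero : P 0)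
    (add : ∀ f h, P f → P h → P (f + h)) : P f := by
  rw [f.as_sum_support_C_mul_X_pow]
  refine Finset.sum_induction _ P add zero fun d hd => ?_
  obtain ⟨i, rfl⟩ := hf d hd
  exact monomial _ i

end Basic

section Degree

variable {K : Type*} [Field K] {q : ℕ}

theorem qdeg_zero : qdeg q (0 : K[X]) = ⊥ := by simp [qdeg]

theorem qdeg_eq_bot {f : K[X]} : qdeg q f = ⊥ ↔ f = 0 := by
  by_cases h : f = 0 <;> simp [qdeg, h]

/-- The degree of a nonzero linearized polynomial is `q` to the power of its `q`-degree. -/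
theorem IsLinearized.exists_natDegree {f : K[X]} (hq : 1 < q) (hf : IsLinearized q f)
    (h0 : f ≠ 0) : ∃ d : ℕ, qdeg q f = d ∧ f.natDegree = q ^ d := by
  obtain ⟨d, hd⟩ := hf _ (natDegree_mem_support_of_nonzero h0)
  exact ⟨d, by rw [qdeg, if_neg h0, hd, Nat.log_pow hq], hd⟩

theorem IsLinearized.natDegree_of_qdeg {f : K[X]} (hq : 1 < q) (hf : IsLinearized q f) {d : ℕ}
    (hd : qdeg q f = d) : f ≠ 0 ∧ f.natDegree = q ^ d := by
  have h0 : f ≠ 0 := fun h => by rw [qdeg_eq_bot.mpr h] at hd; exact absurd hd (by simp)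
  obtain ⟨e, he, he'⟩ := hf.exists_natDegree hq h0
  rw [he] at hd
  have : e = d := by exact_mod_cast hd
  exact ⟨h0, this ▸ he'⟩

theorem qdeg_of_natDegree {f : K[X]} (hq : 1 < q) {d : ℕ}
    (hd : f.natDegree = q ^ d) : qdeg q f = d := by
  have h0 : f ≠ 0 := fun h => by
    rw [h, natDegree_zero] at hd
    exact absurd hd (pow_pos (by omega) d).ne
  rw [qdeg, if_neg h0, hd, Nat.log_pow hq]

theorem qdeg_mono {f h : K[X]} (hd : f.degree ≤ h.degree) : qdeg q f ≤ qdeg q h := by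
  by_cases h0 : h = 0
  · rw [h0, degree_zero, le_bot_iff, degree_eq_bot] at hd
    rw [hd, h0]
  by_cases hf0 : f = 0
  · rw [hf0, qdeg_zero]; exact bot_le
  · rw [qdeg, qdeg, if_neg h0, if_neg hf0]
    exact_mod_cast Nat.log_mono_right (natDegree_le_natDegree hd)

theorem qdeg_add_le (f h : K[X]) : qdeg q (f + h) ≤ max (qdeg q f) (qdeg q h) := by
  rcases le_total f.degree h.degree with hd | hd
  · exact (qdeg_mono ((degree_add_le f h).trans (max_eq_right hd).le)).trans (le_max_right _ _)
  · exact (qdeg_mono ((degree_add_le f h).trans (max_eq_left hd).le)).trans (le_max_left _ _)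

theorem qdeg_neg (f : K[X]) : qdeg q (-f) = qdeg q f :=
  le_antisymm (qdeg_mono (degree_neg f).le) (qdeg_mono (degree_neg f).ge)

theorem qdeg_C_mul {c : K} (hc : c ≠ 0) (f : K[X]) : qdeg q (C c * f) = qdeg q f :=
  le_antisymm (qdeg_mono (degree_C_mul hc).le) (qdeg_mono (degree_C_mul hc).ge)

theorem IsLinearized.qdeg_lt_qdeg {f h : K[X]} (hq : 1 < q) (hf : IsLinearized q f)
    (hh : IsLinearized q h) (hd : f.degree < h.degree) : qdeg q f < qdeg q h := by
  have h0 : h ≠ 0 := by rintro rfl; simp at hd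
  obtain ⟨e, he, he'⟩ := hh.exists_natDegree hq h0
  by_cases hf0 : f = 0
  · rw [hf0, qdeg_zero, he]; exact WithBot.bot_lt_coe _
  obtain ⟨d, hd1, hd2⟩ := hf.exists_natDegree hq hf0
  rw [degree_eq_natDegree hf0, degree_eq_natDegree h0, hd2, he'] at hd
  rw [hd1, he]
  exact_mod_cast (Nat.pow_lt_pow_iff_right hq).mp (by exact_mod_cast hd)

theorem degree_lt_of_qdeg_lt {f h : K[X]} (hd : qdeg q f < qdeg q h) : f.degree < h.degree := by
  by_contra! hle
  exact absurd (qdeg_mono (q := q) hle) (not_le_of_gt hd)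

theorem qdeg_add_eq_right {f h : K[X]} (hd : qdeg q f < qdeg q h) :
    qdeg q (f + h) = qdeg q h := by
  have := degree_add_eq_right_of_degree_lt (degree_lt_of_qdeg_lt hd)
  exact le_antisymm (qdeg_mono this.le) (qdeg_mono this.ge)

theorem qdeg_add_eq_left {f h : K[X]} (hd : qdeg q h < qdeg q f) :
    qdeg q (f + h) = qdeg q f := by
  rw [add_comm, qdeg_add_eq_right hd]

theorem IsLinearized.coeff_ne_zero_of_qdeg {f : K[X]} (hq : 1 < q) (hf : IsLinearized q f) {d : ℕ}
    (hd : qdeg q f = d) : f.coeff (q ^ d) ≠ 0 := by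
  obtain ⟨h0, h1⟩ := hf.natDegree_of_qdeg hq hd
  rw [← h1]
  exact leadingCoeff_ne_zero.mpr h0

theorem le_qdeg_of_coeff_ne_zero {f : K[X]} (hq : 1 < q) {i : ℕ}
    (hi : f.coeff (q ^ i) ≠ 0) : (i : WithBot ℕ) ≤ qdeg q f := by
  have h0 : f ≠ 0 := by rintro rfl; simp at hi
  have h1 := Nat.log_mono_right (b := q) (le_natDegree_of_ne_zero hi)
  rw [Nat.log_pow hq] at h1
  rw [qdeg, if_neg h0]
  exact_mod_cast h1

theorem qdeg_X_pow (hq : 1 < q) (i : ℕ) : qdeg q (X ^ q ^ i : K[X]) = i :=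
  qdeg_of_natDegree hq (natDegree_X_pow _)

theorem qdeg_comp {a f : K[X]} (hq : 1 < q) (ha : IsLinearized q a) (hf : IsLinearized q f) :
    qdeg q (a.comp f) = qdeg q a + qdeg q f := by
  -- a linearized polynomial has no constant term
  have hcoeff : a.coeff 0 = 0 := by
    by_contra h
    obtain ⟨i, hi⟩ := ha 0 (mem_support_iff.mpr h)
    exact absurd hi (pow_pos (by omega) i).ne
  by_cases ha0 : a = 0
  · simp [ha0, qdeg_zero]
  by_cases hf0 : f = 0
  · simp [hf0, qdeg_zero, hcoeff, ← coeff_zero_eq_eval_zero]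
  obtain ⟨d, hd, hd'⟩ := ha.exists_natDegree hq ha0
  obtain ⟨e, he, he'⟩ := hf.exists_natDegree hq hf0
  rw [hd, he, qdeg_of_natDegree (d := d + e) hq
    (by rw [natDegree_comp, hd', he', pow_add])]
  norm_cast

end Degree

section Additive

variable (F : Type*) {K : Type*} [Field F] [Fintype F] [Field K] [Algebra F K]

/-- The map `x ↦ x^(q^i)` on an `F`-algebra is `F`-linear. -/
theorem exists_linearMap_pow (A : Type*) [CommRing A] [Algebra F A] (i : ℕ) :
    ∃ φ : A →ₗ[F] A, ∀ x, φ x = x ^ Fintype.card F ^ i := by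
  refine ⟨(FiniteField.frobeniusAlgHom F A ^ i).toLinearMap, fun x => ?_⟩
  rw [AlgHom.toLinearMap_apply, AlgHom.coe_pow, FiniteField.coe_frobeniusAlgHom, pow_iterate]

variable {F}

/-- A `q`-linearized polynomial over `K` acts `F`-linearly on every commutative `K`-algebra; the
algebras `K` and `K[X]` give evaluation and composition. -/
theorem IsLinearized.exists_linearMap {f : K[X]} (hf : IsLinearized (Fintype.card F) f)
    (A : Type*) [CommRing A] [Algebra K A] [Algebra F A] [IsScalarTower F K A] :
    ∃ φ : A →ₗ[F] A, ∀ x, φ x = aeval x f := by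
  refine hf.induction (P := fun f => ∃ φ : A →ₗ[F] A, ∀ x, φ x = aeval x f) ?_ ?_ ?_
  · intro c i
    obtain ⟨φ, hφ⟩ := exists_linearMap_pow F A i
    exact ⟨(LinearMap.mulLeft F (algebraMap K A c)).comp φ, fun x => by simp [hφ]⟩
  · exact ⟨0, fun x => by simp⟩
  · rintro f h ⟨φ, hφ⟩ ⟨ψ, hψ⟩
    exact ⟨φ + ψ, fun x => by simp [hφ, hψ]⟩

theorem IsLinearized.exists_evalMap {f : K[X]} (hf : IsLinearized (Fintype.card F) f) :
    ∃ φ : K →ₗ[F] K, ∀ x, φ x = f.eval x := by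
  simpa [coe_aeval_eq_eval] using hf.exists_linearMap K

theorem IsLinearized.comp_add {f : K[X]} (hf : IsLinearized (Fintype.card F) f) (a b : K[X]) :
    f.comp (a + b) = f.comp a + f.comp b := by
  obtain ⟨φ, hφ⟩ := hf.exists_linearMap K[X]
  simpa [hφ, Polynomial.aeval_def, Polynomial.comp] using map_add φ a b

theorem IsLinearized.comp_neg {f : K[X]} (hf : IsLinearized (Fintype.card F) f) (a : K[X]) :
    f.comp (-a) = -f.comp a := by
  obtain ⟨φ, hφ⟩ := hf.exists_linearMap K[X]
  simpa [hφ, Polynomial.aeval_def, Polynomial.comp] using map_neg φ a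

theorem IsLinearized.comp_sub {f : K[X]} (hf : IsLinearized (Fintype.card F) f) (a b : K[X]) :
    f.comp (a - b) = f.comp a - f.comp b := by
  rw [sub_eq_add_neg, hf.comp_add, hf.comp_neg, sub_eq_add_neg]

theorem IsLinearized.comp_zero {f : K[X]} (hf : IsLinearized (Fintype.card F) f) :
    f.comp 0 = 0 := by
  simpa using hf.comp_sub 0 0

theorem IsLinearized.comp {a f : K[X]} (ha : IsLinearized (Fintype.card F) a)
    (hf : IsLinearized (Fintype.card F) f) : IsLinearized (Fintype.card F) (a.comp f) := by
  refine ha.induction (P := fun a => IsLinearized (Fintype.card F) (a.comp f)) ?_ ?_ ?_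
  · intro c i
    rw [mul_comp, C_comp, pow_comp, X_comp]
    refine IsLinearized.C_mul ?_ c
    obtain ⟨φ, hφ⟩ := exists_linearMap_pow F K[X] i
    rw [← hφ]
    refine hf.induction (P := fun f => IsLinearized (Fintype.card F) (φ f)) ?_ ?_ ?_
    · intro d j
      rw [hφ, mul_pow, ← C_pow, ← pow_mul, ← pow_add]
      exact isLinearized_C_mul_X_pow _ _
    · simpa using isLinearized_zero
    · intro x y hx hy
      rw [map_add]; exact hx.add hy
  · simpa using isLinearized_zero
  · intro x y hx hy
    rw [add_comp]; exact hx.add hy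

/-- The leading term of `h` can be cancelled by a left multiple of `P` whenever
`qdeg P ≤ qdeg h`. -/
theorem IsLinearized.exists_cancel_leading {h P : K[X]} (hh : IsLinearized (Fintype.card F) h)
    (hP : IsLinearized (Fintype.card F) P) (hP0 : P ≠ 0) (hh0 : h ≠ 0)
    (hle : qdeg (Fintype.card F) P ≤ qdeg (Fintype.card F) h) :
    ∃ a : K[X], IsLinearized (Fintype.card F) a ∧
      qdeg (Fintype.card F) a + qdeg (Fintype.card F) P = qdeg (Fintype.card F) h ∧
      qdeg (Fintype.card F) (h - a.comp P) < qdeg (Fintype.card F) h := by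
  have hq : 1 < Fintype.card F := Fintype.one_lt_card
  obtain ⟨d, hd, hd'⟩ := hP.exists_natDegree hq hP0
  obtain ⟨e, he, he'⟩ := hh.exists_natDegree hq hh0
  have hde : d ≤ e := by rw [hd, he] at hle; exact_mod_cast hle
  obtain ⟨i, rfl⟩ := Nat.exists_eq_add_of_le' hde
  set c : K := h.leadingCoeff / P.leadingCoeff ^ Fintype.card F ^ i with hc
  have hlc : P.leadingCoeff ^ Fintype.card F ^ i ≠ 0 :=
    pow_ne_zero _ (leadingCoeff_ne_zero.mpr hP0)
  have hc0 : c ≠ 0 := div_ne_zero (leadingCoeff_ne_zero.mpr hh0) hlc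
  have ha := isLinearized_C_mul_X_pow (q := Fintype.card F) c i
  have hqa : qdeg (Fintype.card F) (C c * X ^ Fintype.card F ^ i) = i := by
    rw [qdeg_C_mul hc0, qdeg_X_pow hq]
  refine ⟨_, ha, by rw [hqa, hd, he]; norm_cast, ?_⟩
  refine (hh.sub (ha.comp hP)).qdeg_lt_qdeg hq hh (degree_sub_lt_left ?_ hh0 ?_)
  · rw [mul_comp, C_comp, X_pow_comp, degree_C_mul hc0, degree_pow, degree_eq_natDegree hP0,
      degree_eq_natDegree hh0, he', hd', pow_add]
    simp
  · rw [mul_comp, C_comp, X_pow_comp, leadingCoeff_mul, leadingCoeff_C, leadingCoeff_pow, hc,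
      div_mul_cancel₀ _ hlc]

theorem IsLinearized.comp_left_cancel {f a b : K[X]} (hf : IsLinearized (Fintype.card F) f)
    (hf0 : f ≠ 0) (ha : IsLinearized (Fintype.card F) a) (hb : IsLinearized (Fintype.card F) b)
    (h : f.comp a = f.comp b) : a = b := by
  have h1 : qdeg (Fintype.card F) (f.comp (a - b)) = ⊥ := by
    rw [hf.comp_sub, h, sub_self, qdeg_zero]
  rw [qdeg_comp Fintype.one_lt_card hf (ha.sub hb), WithBot.add_eq_bot, qdeg_eq_bot,
    qdeg_eq_bot] at h1
  exact sub_eq_zero.mp (h1.resolve_left hf0)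

end Additive

section Coefficients

variable {K : Type*} [Field K]

/-- The linearized polynomial with coefficients `c_0, …, c_(d-1)`. -/
noncomputable def ofCoeffs (q : ℕ) {d : ℕ} (c : Fin d → K) : K[X] :=
  ∑ i : Fin d, C (c i) * X ^ q ^ (i : ℕ)

theorem isLinearized_ofCoeffs (q : ℕ) {d : ℕ} (c : Fin d → K) : IsLinearized q (ofCoeffs q c) :=
  IsLinearized.sum fun _ _ => isLinearized_C_mul_X_pow _ _

theorem coeff_ofCoeffs {q : ℕ} (hq : 1 < q) {d : ℕ} (c : Fin d → K) (i : Fin d) :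
    (ofCoeffs q c).coeff (q ^ (i : ℕ)) = c i := by
  simp [ofCoeffs, coeff_X_pow, Nat.pow_right_inj hq, Fin.val_inj]

theorem qdeg_ofCoeffs_lt {q : ℕ} (hq : 1 < q) {d : ℕ} (c : Fin d → K) :
    qdeg q (ofCoeffs q c) < (d : WithBot ℕ) := by
  by_cases h0 : ofCoeffs q c = 0
  · rw [h0, qdeg_zero]; exact WithBot.bot_lt_coe _
  obtain ⟨e, he, he'⟩ := (isLinearized_ofCoeffs q c).exists_natDegree hq h0
  have hne := (isLinearized_ofCoeffs q c).coeff_ne_zero_of_qdeg hq he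
  rw [he]
  by_contra hlt
  have hde : d ≤ e := by
    by_contra h; exact hlt (by exact_mod_cast not_le.mp h)
  refine hne ?_
  simp only [ofCoeffs, finsetSum_coeff, coeff_C_mul, coeff_X_pow, Nat.pow_right_inj hq]
  exact Finset.sum_eq_zero fun i _ => by rw [if_neg (by have := i.2; omega), mul_zero]

theorem IsLinearized.eq_ofCoeffs {q : ℕ} (hq : 1 < q) {f : K[X]} (hf : IsLinearized q f) {d : ℕ}
    (hd : qdeg q f < (d : WithBot ℕ)) :
    f = ofCoeffs q fun i : Fin d => f.coeff (q ^ (i : ℕ)) := by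
  ext e
  by_cases he : ∃ i, e = q ^ i
  · obtain ⟨i, rfl⟩ := he
    by_cases hi : i < d
    · exact (coeff_ofCoeffs hq (fun i : Fin d => f.coeff (q ^ (i : ℕ))) ⟨i, hi⟩).symm
    · have hz : ∀ h : K[X], qdeg q h < (d : WithBot ℕ) → h.coeff (q ^ i) = 0 := by
        intro h hh
        by_contra hne
        have := (le_qdeg_of_coeff_ne_zero hq hne).trans_lt hh
        exact hi (by exact_mod_cast this)
      rw [hz f hd, hz _ (qdeg_ofCoeffs_lt hq _)]
  · have hz : ∀ h : K[X], IsLinearized q h → h.coeff e = 0 := fun h hh => by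
      by_contra hne
      exact he (hh e (mem_support_iff.mpr hne))
    rw [hz f hf, hz _ (isLinearized_ofCoeffs q _)]

end Coefficients

/-! ### Annihilator polynomials and right division -/

section Vanishing

variable {F K : Type*} [Field F] [Fintype F] [Field K] [Algebra F K]

/-- A linearized polynomial that vanishes on generators vanishes on their span. -/
theorem IsLinearized.eval_eq_zero_of_mem_span {f : K[X]}
    (hf : IsLinearized (Fintype.card F) f) {S : Set K} (hS : ∀ x ∈ S, f.eval x = 0) {x : K}
    (hx : x ∈ Submodule.span F S) : f.eval x = 0 := by
  obtain ⟨φ, hφ⟩ := hf.exists_evalMap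
  have : Submodule.span F S ≤ LinearMap.ker φ :=
    Submodule.span_le.mpr fun y hy => by simpa [hφ] using hS y hy
  simpa [hφ] using this hx

end Vanishing

section Annihilator

variable {F K : Type*} [Field F] [Fintype F] [Field K] [Fintype K] [Algebra F K]

/-- A linearized polynomial of `q`-degree below the dimension of a subspace on which it vanishes is
zero, since the subspace has more elements than the polynomial can have roots. -/
theorem IsLinearized.eq_zero_of_vanishes {f : K[X]} (hf : IsLinearized (Fintype.card F) f)
    (V : Submodule F K) (hV : ∀ x ∈ V, f.eval x = 0)
    (hd : qdeg (Fintype.card F) f < (Module.finrank F V : ℕ)) : f = 0 := by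
  classical
  by_contra h0
  obtain ⟨d, hd1, hd2⟩ := hf.exists_natDegree Fintype.one_lt_card h0
  rw [hd1] at hd
  have hlt : d < Module.finrank F V := by exact_mod_cast hd
  refine h0 (eq_zero_of_natDegree_lt_card_of_eval_eq_zero f (f := fun x : V => (x : K))
    Subtype.val_injective (fun x => hV x x.2) ?_)
  rw [hd2, Module.card_eq_pow_finrank (K := F) (V := V)]
  exact Nat.pow_lt_pow_right Fintype.one_lt_card hlt

/-- For every `F`-subspace `V` of dimension `d` there is a monic linearized polynomial of `q`-degree
`d` vanishing on `V`: a linearized polynomial has one coefficient more than the number of linear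
conditions imposed by a basis of `V`. -/
theorem exists_monic_vanishing (V : Submodule F K) :
    ∃ P : K[X], IsLinearized (Fintype.card F) P ∧ P.Monic ∧
      qdeg (Fintype.card F) P = (Module.finrank F V : ℕ) ∧ ∀ x ∈ V, P.eval x = 0 := by
  have hq : 1 < Fintype.card F := Fintype.one_lt_card
  set d := Module.finrank F V with hd
  let b := Module.finBasis F V
  let φ : (Fin (d + 1) → K) →ₗ[K] (Fin d → K) :=
    { toFun := fun c j => (ofCoeffs (Fintype.card F) c).eval (b j : K)
      map_add' := fun c c' => by
        ext j; simp [ofCoeffs, eval_finsetSum, add_mul, Finset.sum_add_distrib]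
      map_smul' := fun c c' => by
        ext j; simp [ofCoeffs, eval_finsetSum, Finset.mul_sum, mul_assoc] }
  obtain ⟨c, hc, hc0⟩ := (Submodule.ne_bot_iff _).mp
    (LinearMap.ker_ne_bot_of_finrank_lt (f := φ) (by simp))
  set f := ofCoeffs (Fintype.card F) c with hf
  have hlin : IsLinearized (Fintype.card F) f := isLinearized_ofCoeffs _ c
  have hf0 : f ≠ 0 := fun h => hc0 (by
    ext i; rw [← coeff_ofCoeffs hq c i, ← hf, h]; simp)
  have hV : ∀ x ∈ V, f.eval x = 0 := by
    intro x hx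
    refine hlin.eval_eq_zero_of_mem_span (S := Set.range fun j => (b j : K)) ?_ ?_
    · rintro _ ⟨j, rfl⟩
      exact congrFun hc j
    · have hx' : x = ∑ j, b.repr ⟨x, hx⟩ j • (b j : K) := by
        have h1 : ((∑ j, b.repr ⟨x, hx⟩ j • b j : V) : K) = x := by rw [b.sum_repr]
        simpa only [Submodule.coe_sum, Submodule.coe_smul] using h1.symm
      rw [hx']
      exact Submodule.sum_mem _ fun j _ => Submodule.smul_mem _ _ (Submodule.subset_span ⟨j, rfl⟩)
  have hlc : f.leadingCoeff⁻¹ ≠ 0 := inv_ne_zero (leadingCoeff_ne_zero.mpr hf0)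
  refine ⟨C f.leadingCoeff⁻¹ * f, hlin.C_mul _, ?_, ?_, fun x hx => by simp [hV x hx]⟩
  · rw [Monic, leadingCoeff_mul, leadingCoeff_C,
      inv_mul_cancel₀ (leadingCoeff_ne_zero.mpr hf0)]
  · rw [qdeg_C_mul hlc]
    obtain ⟨e, he, -⟩ := hlin.exists_natDegree hq hf0
    refine le_antisymm ?_ ?_
    · have := qdeg_ofCoeffs_lt hq c
      rw [← hf, he] at this
      rw [he]
      have h2 : e < d + 1 := by exact_mod_cast this
      exact_mod_cast Nat.lt_succ_iff.mp h2
    · by_contra hlt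
      exact hf0 (hlin.eq_zero_of_vanishes V hV (not_le.mp hlt))

/-- The polynomial `Π` is the monic linearized polynomial vanishing on the span of the `g_i`. -/
theorem annihilatorPoly_spec {n : ℕ} (g : Fin n → K) :
    IsLinearized (Fintype.card F) (annihilatorPoly F g) ∧
      qdeg (Fintype.card F) (annihilatorPoly F g) =
        (Module.finrank F (Submodule.span F (Set.range g)) : ℕ) ∧
      ∀ x ∈ Submodule.span F (Set.range g), (annihilatorPoly F g).eval x = 0 := by
  classical
  have hq : 1 < Fintype.card F := Fintype.one_lt_card
  obtain ⟨P, hP, hmon, hdeg, hV⟩ := exists_monic_vanishing (F := F) (Submodule.span F (Set.range g))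
  suffices h : annihilatorPoly F g = P by rw [h]; exact ⟨hP, hdeg, hV⟩
  set S := Finset.univ.filter (fun α : K => α ∈ Submodule.span F (Set.range g)) with hS
  have hdvd : ∏ α ∈ S, (X - C α) ∣ P := by
    refine Finset.prod_dvd_of_coprime ?_ ?_
    · exact fun a _ b _ hab => isCoprime_X_sub_C_of_isUnit_sub (sub_ne_zero.mpr hab).isUnit
    · intro α hα
      exact dvd_iff_isRoot.mpr (hV α (by simpa [hS] using hα))
  have hnat : (∏ α ∈ S, (X - C α)).natDegree = P.natDegree := by
    rw [natDegree_prod_of_monic _ _ fun α _ => monic_X_sub_C α, (hP.natDegree_of_qdeg hq hdeg).2,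
      ← Module.card_eq_pow_finrank (K := F)]
    simp [hS, Fintype.card_subtype]
  have := eq_of_monic_of_dvd_of_natDegree_le (monic_prod_of_monic _ _ fun α _ => monic_X_sub_C α)
    hmon hdvd hnat.ge
  unfold annihilatorPoly
  convert this.symm

/-- A linearized polynomial that vanishes at the `g_i` is a left multiple of `Π`, by division with
remainder on the right. -/
theorem IsLinearized.exists_comp_annihilatorPoly {n : ℕ} (g : Fin n → K) {h : K[X]}
    (hh : IsLinearized (Fintype.card F) h) (hg : ∀ i, h.eval (g i) = 0) :
    ∃ a : K[X], IsLinearized (Fintype.card F) a ∧ h = a.comp (annihilatorPoly F g) := by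
  obtain ⟨hP, hPd, hPV⟩ := annihilatorPoly_spec (F := F) g
  set P := annihilatorPoly F g
  have hP0 : P ≠ 0 := (hP.natDegree_of_qdeg Fintype.one_lt_card hPd).1
  induction hd : qdeg (Fintype.card F) h using WellFoundedLT.induction generalizing h with
  | ind d ih =>
    by_cases hlt : d < qdeg (Fintype.card F) P
    · refine ⟨0, isLinearized_zero, ?_⟩
      rw [zero_comp]
      refine hh.eq_zero_of_vanishes (Submodule.span F (Set.range g)) (fun x hx => ?_)
        (by rwa [← hPd, hd])
      exact hh.eval_eq_zero_of_mem_span (by rintro _ ⟨i, rfl⟩; exact hg i) hx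
    · have hh0 : h ≠ 0 := by
        rintro rfl
        rw [qdeg_zero] at hd
        rw [← hd, hPd] at hlt
        exact hlt (WithBot.bot_lt_coe _)
      obtain ⟨a, ha, -, hlt'⟩ := hh.exists_cancel_leading hP hP0 hh0
        (by rw [hd]; exact not_lt.mp hlt)
      have ha0 := ha.comp_zero
      obtain ⟨b, hb, hb'⟩ := ih _ (hd ▸ hlt') (hh.sub (ha.comp hP)) (fun i => by
        rw [eval_sub, hg i, eval_comp, hPV _ (Submodule.subset_span ⟨i, rfl⟩), zero_sub,
          neg_eq_zero]
        simpa using congrArg (eval 0) ha0) rfl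
      refine ⟨b + a, hb.add ha, ?_⟩
      rw [add_comp, ← hb', sub_add_cancel]

end Annihilator

/-! ### The `q`-Lagrange polynomial -/

section LagrangeMinors

variable {K : Type*} [Field K]

theorem isLinearized_det_lagrangeMinor (q : ℕ) {n : ℕ} (g : Fin n → K) (i : Fin n) :
    IsLinearized q (lagrangeMinor q g i).det := by
  obtain _ | n := n
  · exact i.elim0
  -- expand along the last column, the only one that is not constant
  rw [Matrix.det_succ_column _ (Fin.last n)]
  refine IsLinearized.sum fun j _ => ?_
  have hlast : lagrangeMinor q g i j (Fin.last n) = X ^ q ^ (j : ℕ) := by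
    have : i.castSucc.succAbove (Fin.last n) = Fin.last (n + 1) := by
      rw [Fin.succAbove_of_le_castSucc _ _ (by simpa [Fin.le_def] using Nat.lt_succ_iff.mp i.2)]
      rfl
    simp [lagrangeMinor, mooreMatrix, this]
  have hminor : (lagrangeMinor q g i).submatrix j.succAbove (Fin.last n).succAbove =
      (C : K →+* K[X]).mapMatrix (Matrix.of fun (a b : Fin n) =>
        g (i.succAbove b) ^ q ^ (j.succAbove a : ℕ)) := by
    ext1 a b
    have : i.castSucc.succAbove b.castSucc = (i.succAbove b).castSucc := by simp
    simp [lagrangeMinor, mooreMatrix, this]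
  rw [hlast, hminor, ← RingHom.map_det, show ((-1 : K[X]) ^ ((j : ℕ) + (Fin.last n : ℕ))) =
    C ((-1) ^ ((j : ℕ) + (Fin.last n : ℕ))) by simp, mul_right_comm, ← C_mul]
  exact isLinearized_C_mul_X_pow _ _

theorem isLinearized_lagrangePoly (q : ℕ) {n : ℕ} (g r : Fin n → K) :
    IsLinearized q (lagrangePoly q g r) := by
  refine IsLinearized.sum fun i _ => ?_
  rw [show ((-1 : K[X]) ^ (n - ((i : ℕ) + 1))) = C ((-1) ^ (n - ((i : ℕ) + 1))) by simp, ← C_mul]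
  exact (isLinearized_det_lagrangeMinor q g i).C_mul _

/-- The columns of `𝔇_i(g_i)` are those of `M_n(g)`, permuted by the cycle that moves column `i`
to the end; for `j ≠ i` the matrix `𝔇_i(g_j)` has two equal columns. -/
theorem eval_det_lagrangeMinor (q : ℕ) {n : ℕ} (g : Fin n → K) (i j : Fin n) :
    (lagrangeMinor q g i).det.eval (g j) =
      if j = i then (-1) ^ (n - ((i : ℕ) + 1)) * (mooreMatrix q n g).det else 0 := by
  obtain _ | n := n
  · exact i.elim0
  have hmap : (lagrangeMinor q g i).det.eval (g j) = (mooreMatrix q (n + 1)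
      ((Fin.snoc (α := fun _ => K) g (g j)) ∘ i.castSucc.succAbove)).det := by
    rw [← coe_evalRingHom, RingHom.map_det]
    congr 1
    ext a b
    simp only [lagrangeMinor, mooreMatrix, RingHom.mapMatrix_apply, Matrix.map_apply,
      Matrix.submatrix_apply, Matrix.of_apply, id, coe_evalRingHom, eval_pow, Function.comp]
    congr 1
    refine Fin.lastCases ?_ (fun l => ?_) (i.castSucc.succAbove b) <;> simp
  have hlast : i.castSucc.succAbove (Fin.last n) = Fin.last (n + 1) := by
    rw [Fin.succAbove_of_le_castSucc _ _ (by simpa [Fin.le_def] using Nat.lt_succ_iff.mp i.2)]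
    rfl
  rw [hmap]
  split_ifs with hji
  · subst hji
    have hcol : (Fin.snoc (α := fun _ => K) g (g j)) ∘ j.castSucc.succAbove =
        g ∘ Fin.cycleIcc j (Fin.last n) := by
      funext b
      refine Fin.lastCases ?_ (fun l => ?_) b
      · simp only [Function.comp, hlast, Fin.snoc_last]
        rw [Fin.cycleIcc_of_last (Fin.le_last j)]
      · have h1 : j.castSucc.succAbove l.castSucc = (j.succAbove l).castSucc := by simp
        have h2 := congrFun (Fin.cycleIcc_comp_succAbove j (Fin.last n) (Fin.le_last j)) l
        simp only [Function.comp, Fin.succAbove_last] at h2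
        simp only [Function.comp, h1, h2, Fin.snoc_castSucc]
    have hperm : mooreMatrix q (n + 1) (g ∘ Fin.cycleIcc j (Fin.last n)) =
        (mooreMatrix q (n + 1) g).submatrix id (Fin.cycleIcc j (Fin.last n)) := rfl
    rw [hcol, hperm, Matrix.det_permute', Fin.sign_cycleIcc_of_le (Fin.le_last j)]
    have : n + 1 - ((j : ℕ) + 1) = n - j := by omega
    simp [this]
  · obtain ⟨l, hl⟩ := Fin.exists_succAbove_eq hji
    refine Matrix.det_zero_of_column_eq (i := l.castSucc) (j := Fin.last n)
      (Fin.castSucc_lt_last l).ne fun a => ?_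
    have h1 : i.castSucc.succAbove l.castSucc = (i.succAbove l).castSucc := by simp
    simp only [mooreMatrix, Matrix.of_apply, Function.comp, h1, hlast, hl, Fin.snoc_castSucc,
      Fin.snoc_last]

end LagrangeMinors

section Lagrange

variable {F K : Type*} [Field F] [Fintype F] [Field K] [Fintype K] [Algebra F K]

theorem det_mooreMatrix_ne_zero {n : ℕ} {g : Fin n → K} (hg : LinearIndependent F g) :
    (mooreMatrix (Fintype.card F) n g).det ≠ 0 := by
  have hq : 1 < Fintype.card F := Fintype.one_lt_card
  intro hdet
  -- a vanishing combination of the rows is a linearized polynomial of too small a degree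
  obtain ⟨c, hc0, hc⟩ := Matrix.exists_vecMul_eq_zero_iff.mpr hdet
  have hlin := isLinearized_ofCoeffs (Fintype.card F) c
  have hz : ofCoeffs (Fintype.card F) c = 0 := by
    refine hlin.eq_zero_of_vanishes (Submodule.span F (Set.range g)) (fun x hx => ?_) ?_
    · refine hlin.eval_eq_zero_of_mem_span ?_ hx
      rintro _ ⟨j, rfl⟩
      have := congrFun hc j
      simpa [ofCoeffs, eval_finsetSum, Matrix.vecMul, dotProduct, mooreMatrix] using this
    · rw [finrank_span_eq_card hg, Fintype.card_fin]
      exact qdeg_ofCoeffs_lt hq c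
  exact hc0 (by ext i; rw [← coeff_ofCoeffs hq c i, hz]; simp)

theorem eval_lagrangePoly {n : ℕ} {g : Fin n → K} (hg : LinearIndependent F g) (r : Fin n → K)
    (j : Fin n) : (lagrangePoly (Fintype.card F) g r).eval (g j) = r j := by
  have hdet := det_mooreMatrix_ne_zero hg
  rw [lagrangePoly, eval_finsetSum, Finset.sum_eq_single j]
  · rw [eval_mul, eval_det_lagrangeMinor, if_pos rfl]
    simp only [eval_mul, eval_pow, eval_neg, eval_one, eval_C]
    have hs : ((-1 : K) ^ (n - ((j : ℕ) + 1))) * (-1) ^ (n - ((j : ℕ) + 1)) = 1 := by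
      rw [← mul_pow]; simp
    calc _ = ((-1 : K) ^ (n - ((j : ℕ) + 1)) * (-1) ^ (n - ((j : ℕ) + 1))) * r j *
          ((mooreMatrix (Fintype.card F) n g).det⁻¹ * (mooreMatrix (Fintype.card F) n g).det) := by
            ring
      _ = r j := by rw [hs, inv_mul_cancel₀ hdet]; ring
  · intro i _ hij
    rw [eval_mul, eval_det_lagrangeMinor, if_neg hij.symm, mul_zero]
  · simp

end Lagrange

/-! ### The interpolation module -/

section Module

variable {F K : Type*} [Field F] [Fintype F] [Field K] [Fintype K] [Algebra F K]

/-- The interpolation module consists of the linearized pairs `[N  -D]` with `N(g_i) = D(r_i)`. -/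
theorem mem_interpolationModule_iff {n : ℕ} {g : Fin n → K} (hg : LinearIndependent F g)
    (r : Fin n → K) (f : Fin 2 → K[X]) :
    f ∈ interpolationModule F (Fintype.card F) g r ↔
      IsLinearized (Fintype.card F) (f 0) ∧ IsLinearized (Fintype.card F) (f 1) ∧
        ∀ i, (f 0).eval (g i) + (f 1).eval (r i) = 0 := by
  obtain ⟨hP, -, hPV⟩ := annihilatorPoly_spec (F := F) g
  have hL := isLinearized_lagrangePoly (Fintype.card F) g r
  have hLg := eval_lagrangePoly hg r
  constructor
  · rintro ⟨a, b, ha, hb, rfl⟩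
    have ha0 : a.eval 0 = 0 := by simpa using congrArg (eval 0) ha.comp_zero
    simp only [compRow, Pi.add_apply, Matrix.cons_val_zero, Matrix.cons_val_one, ha.comp_zero,
      comp_X, zero_add]
    refine ⟨(ha.comp hP).add (hb.comp hL.neg), hb, fun i => ?_⟩
    rw [hb.comp_neg, eval_add, eval_neg, eval_comp, eval_comp, hLg,
      hPV _ (Submodule.subset_span ⟨i, rfl⟩), ha0]
    ring
  · rintro ⟨h0, h1, hfr⟩
    obtain ⟨a, ha, ha'⟩ := (h0.add (h1.comp hL)).exists_comp_annihilatorPoly g (fun i => by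
      rw [eval_add, eval_comp, hLg, hfr])
    refine ⟨a, f 1, ha, h1, ?_⟩
    funext p
    fin_cases p
    · simp [compRow, ← ha', h1.comp_neg]
    · simp [compRow, ha.comp_zero]

end Module

/-! ### Leading monomials -/

section LeadingMonomial

variable {K : Type*} [Field K] {q κ : ℕ}

theorem IsLinearized.qdeg_eq_coe_iff {f : K[X]} (hq : 1 < q) (hf : IsLinearized q f) {i : ℕ} :
    qdeg q f = i ↔ f.coeff (q ^ i) ≠ 0 ∧ ∀ j, f.coeff (q ^ j) ≠ 0 → j ≤ i := by
  constructor
  · refine fun h => ⟨hf.coeff_ne_zero_of_qdeg hq h, fun j hj => ?_⟩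
    have := le_qdeg_of_coeff_ne_zero hq hj
    rw [h] at this
    exact_mod_cast this
  · rintro ⟨h1, h2⟩
    have h0 : f ≠ 0 := by rintro rfl; simp at h1
    obtain ⟨d, hd, -⟩ := hf.exists_natDegree hq h0
    have h3 := le_qdeg_of_coeff_ne_zero hq h1
    have h4 := h2 d (hf.coeff_ne_zero_of_qdeg hq hd)
    rw [hd] at h3 ⊢
    have h5 : i ≤ d := by exact_mod_cast h3
    rw [le_antisymm h4 h5]

theorem IsLinearized.qdeg_le_coe_iff {f : K[X]} (hq : 1 < q) (hf : IsLinearized q f) {i : ℕ} :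
    qdeg q f ≤ i ↔ ∀ j, f.coeff (q ^ j) ≠ 0 → j ≤ i := by
  constructor
  · intro h j hj
    exact_mod_cast (le_qdeg_of_coeff_ne_zero hq hj).trans h
  · intro h
    by_cases h0 : f = 0
    · rw [h0, qdeg_zero]; exact bot_le
    obtain ⟨d, hd, -⟩ := hf.exists_natDegree hq h0
    rw [hd]
    exact_mod_cast h d (hf.coeff_ne_zero_of_qdeg hq hd)

theorem IsLinearized.qdeg_add_lt_coe_iff {f : K[X]} (hq : 1 < q) (hf : IsLinearized q f) {i : ℕ} :
    qdeg q f + (κ : WithBot ℕ) < i ↔ ∀ j, f.coeff (q ^ j) ≠ 0 → j + κ < i := by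
  constructor
  · intro h j hj
    have := (add_le_add_left (le_qdeg_of_coeff_ne_zero hq hj) (κ : WithBot ℕ)).trans_lt h
    exact_mod_cast this
  · intro h
    by_cases h0 : f = 0
    · rw [h0, qdeg_zero, WithBot.bot_add]; exact WithBot.bot_lt_coe _
    obtain ⟨d, hd, -⟩ := hf.exists_natDegree hq h0
    rw [hd]
    exact_mod_cast h d (hf.coeff_ne_zero_of_qdeg hq hd)

variable {f : Fin 2 → K[X]}

theorem isLeadingMonomial_zero_iff (hq : 1 < q) (h0 : IsLinearized q (f 0))
    (h1 : IsLinearized q (f 1)) {i : ℕ} :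
    IsLeadingMonomial q ![0, κ] f (i, 0) ↔
      qdeg q (f 0) = i ∧ qdeg q (f 1) + (κ : WithBot ℕ) < i := by
  rw [h0.qdeg_eq_coe_iff hq, h1.qdeg_add_lt_coe_iff hq]
  constructor
  · rintro ⟨hc, hle⟩
    refine ⟨⟨hc, fun j hj => ?_⟩, fun j hj => ?_⟩
    · have := hle (j, 0) hj
      simp [monomialLE] at this
      omega
    · have := hle (j, 1) hj
      simp [monomialLE] at this
      omega
  · rintro ⟨⟨hc, hle⟩, hlt⟩
    refine ⟨hc, ?_⟩
    rintro ⟨j, p⟩ hj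
    fin_cases p
    · have := hle j hj
      simp [monomialLE]
      omega
    · have := hlt j hj
      simp [monomialLE]
      omega

theorem isLeadingMonomial_one_iff (hq : 1 < q) (h0 : IsLinearized q (f 0))
    (h1 : IsLinearized q (f 1)) {i : ℕ} :
    IsLeadingMonomial q ![0, κ] f (i, 1) ↔
      qdeg q (f 1) = i ∧ qdeg q (f 0) ≤ ((i + κ : ℕ) : WithBot ℕ) := by
  rw [h1.qdeg_eq_coe_iff hq, h0.qdeg_le_coe_iff hq]
  constructor
  · rintro ⟨hc, hle⟩
    refine ⟨⟨hc, fun j hj => ?_⟩, fun j hj => ?_⟩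
    · have := hle (j, 1) hj
      simp [monomialLE] at this
      omega
    · have := hle (j, 0) hj
      simp [monomialLE] at this
      omega
  · rintro ⟨⟨hc, hle⟩, hlt⟩
    refine ⟨hc, ?_⟩
    rintro ⟨j, p⟩ hj
    fin_cases p
    · have := hlt j hj
      simp [monomialLE]
      omega
    · have := hle j hj
      simp [monomialLE]
      omega

theorem exists_isLeadingMonomial (hq : 1 < q) (h0 : IsLinearized q (f 0))
    (h1 : IsLinearized q (f 1)) (hf : f ≠ 0) :
    (∃ i, IsLeadingMonomial q ![0, κ] f (i, 0)) ∨ ∃ i, IsLeadingMonomial q ![0, κ] f (i, 1) := by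
  simp only [isLeadingMonomial_zero_iff hq h0 h1, isLeadingMonomial_one_iff hq h0 h1]
  rcases lt_or_ge (qdeg q (f 1) + (κ : WithBot ℕ)) (qdeg q (f 0)) with h | h
  · obtain ⟨d, hd, -⟩ := h0.exists_natDegree hq (fun hz => by
      rw [hz, qdeg_zero] at h; exact not_lt_bot h)
    exact Or.inl ⟨d, hd, hd ▸ h⟩
  · obtain ⟨d, hd, -⟩ := h1.exists_natDegree hq (fun hz => hf (by
      rw [hz, qdeg_zero, WithBot.bot_add, le_bot_iff, qdeg_eq_bot] at h
      funext p; fin_cases p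
      · exact h
      · exact hz))
    rw [hd] at h
    exact Or.inr ⟨d, hd, by exact_mod_cast h⟩

theorem IsLeadingMonomial.unique {w : Fin 2 → ℕ} {μ ν : ℕ × Fin 2}
    (hμ : IsLeadingMonomial q w f μ) (hν : IsLeadingMonomial q w f ν) : μ = ν := by
  have h1 := hμ.2 ν hν.1
  have h2 := hν.2 μ hμ.1
  obtain ⟨i, p⟩ := μ
  obtain ⟨j, r⟩ := ν
  simp only [monomialLE] at h1 h2
  have hpr : p = r := le_antisymm
    (by rcases h2 with h2 | h2 <;> [skip; exact h2.2]; rcases h1 with h1 | h1 <;> omega)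
    (by rcases h1 with h1 | h1 <;> [skip; exact h1.2]; rcases h2 with h2 | h2 <;> omega)
  subst hpr
  have : i = j := by omega
  rw [this]

end LeadingMonomial

/-! ### Gröbner bases of the interpolation module -/

section Basis

variable {F K : Type*} [Field F] [Fintype F] [Field K] [Fintype K] [Algebra F K]
variable {n : ℕ} {g : Fin n → K} {r : Fin n → K}

theorem add_mem_interpolationModule (hg : LinearIndependent F g) {f h : Fin 2 → K[X]}
    (hf : f ∈ interpolationModule F (Fintype.card F) g r)
    (hh : h ∈ interpolationModule F (Fintype.card F) g r) :
    f + h ∈ interpolationModule F (Fintype.card F) g r := by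
  rw [mem_interpolationModule_iff hg] at hf hh ⊢
  refine ⟨hf.1.add hh.1, hf.2.1.add hh.2.1, fun i => ?_⟩
  have h1 := hf.2.2 i
  have h2 := hh.2.2 i
  simp only [Pi.add_apply, eval_add]
  linear_combination h1 + h2

theorem compRow_mem_interpolationModule (hg : LinearIndependent F g) {a : K[X]}
    (ha : IsLinearized (Fintype.card F) a) {f : Fin 2 → K[X]}
    (hf : f ∈ interpolationModule F (Fintype.card F) g r) :
    compRow a f ∈ interpolationModule F (Fintype.card F) g r := by
  rw [mem_interpolationModule_iff hg] at hf ⊢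
  refine ⟨ha.comp hf.1, ha.comp hf.2.1, fun i => ?_⟩
  obtain ⟨φ, hφ⟩ := ha.exists_evalMap
  simp only [compRow, eval_comp, ← hφ, ← map_add, hf.2.2 i, map_zero]

theorem sub_compRow_mem_interpolationModule (hg : LinearIndependent F g) {a : K[X]}
    (ha : IsLinearized (Fintype.card F) a) {f h : Fin 2 → K[X]}
    (hf : f ∈ interpolationModule F (Fintype.card F) g r)
    (hh : h ∈ interpolationModule F (Fintype.card F) g r) :
    f - compRow a h ∈ interpolationModule F (Fintype.card F) g r := by
  have : f - compRow a h = f + compRow (-a) h := by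
    funext p; simp [compRow, sub_eq_add_neg]
  rw [this]
  exact add_mem_interpolationModule hg hf (compRow_mem_interpolationModule hg ha.neg hh)

/-- The row `[Π  0]`. -/
theorem exists_mem_leadingMonomial_zero (hg : LinearIndependent F g) (r : Fin n → K) (κ : ℕ) :
    ∃ f ∈ interpolationModule F (Fintype.card F) g r, ∃ i,
      IsLeadingMonomial (Fintype.card F) ![0, κ] f (i, 0) := by
  obtain ⟨hP, hPd, hPV⟩ := annihilatorPoly_spec (F := F) g
  refine ⟨![annihilatorPoly F g, 0], ?_, _,
    (isLeadingMonomial_zero_iff Fintype.one_lt_card hP isLinearized_zero).mpr ⟨hPd, ?_⟩⟩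
  · rw [mem_interpolationModule_iff hg]
    exact ⟨hP, isLinearized_zero, fun i => by simp [hPV _ (Submodule.subset_span ⟨i, rfl⟩)]⟩
  · simp only [Matrix.cons_val_one, Matrix.cons_val_zero, qdeg_zero, WithBot.bot_add]
    exact WithBot.bot_lt_coe _

/-- A row `[0  B]`, where `B` vanishes at all the `r_i`. -/
theorem exists_mem_leadingMonomial_one (hg : LinearIndependent F g) (r : Fin n → K) (κ : ℕ) :
    ∃ f ∈ interpolationModule F (Fintype.card F) g r, ∃ i,
      IsLeadingMonomial (Fintype.card F) ![0, κ] f (i, 1) := by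
  obtain ⟨hP, hPd, hPV⟩ := annihilatorPoly_spec (F := F) r
  refine ⟨![0, annihilatorPoly F r], ?_, _,
    (isLeadingMonomial_one_iff Fintype.one_lt_card isLinearized_zero hP).mpr ⟨hPd, ?_⟩⟩
  · rw [mem_interpolationModule_iff hg]
    exact ⟨isLinearized_zero, hP, fun i => by simp [hPV _ (Submodule.subset_span ⟨i, rfl⟩)]⟩
  · simp [qdeg_zero]

/-- Choosing in the module an element of minimal leading monomial for each of the two positions
gives an admissible basis. -/
theorem exists_isAdmissibleBasis (k : ℕ) (hg : LinearIndependent F g) (r : Fin n → K) :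
    ∃ g₁ g₂ : Fin 2 → K[X], IsAdmissibleBasis (Fintype.card F) k
      (interpolationModule F (Fintype.card F) g r) g₁ g₂ := by
  classical
  have hq : 1 < Fintype.card F := Fintype.one_lt_card
  set M := interpolationModule F (Fintype.card F) g r with hM
  have key : ∀ p : Fin 2, ∃ h ∈ M, ∃ i, IsLeadingMonomial (Fintype.card F) ![0, k - 1] h (i, p) ∧
      ∀ f ∈ M, ∀ j, IsLeadingMonomial (Fintype.card F) ![0, k - 1] f (j, p) → i ≤ j := by
    intro p
    have hex : ∃ i, ∃ h ∈ M, IsLeadingMonomial (Fintype.card F) ![0, k - 1] h (i, p) := by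
      have hp : ∃ h ∈ M, ∃ i, IsLeadingMonomial (Fintype.card F) ![0, k - 1] h (i, p) := by
        fin_cases p
        · exact exists_mem_leadingMonomial_zero hg r _
        · exact exists_mem_leadingMonomial_one hg r _
      obtain ⟨h, hh, i, hi⟩ := hp
      exact ⟨i, h, hh, hi⟩
    obtain ⟨h, hh, hi⟩ := Nat.find_spec hex
    exact ⟨h, hh, _, hi, fun f hf j hj => Nat.find_min' hex ⟨f, hf, hj⟩⟩
  have hne : ∀ {f : Fin 2 → K[X]} {μ : ℕ × Fin 2},
      IsLeadingMonomial (Fintype.card F) ![0, k - 1] f μ → f ≠ 0 := by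
    rintro f μ ⟨hc, -⟩ rfl
    simp at hc
  obtain ⟨g₁, hg₁, i₁, hi₁, hmin₁⟩ := key 0
  obtain ⟨g₂, hg₂, i₂, hi₂, hmin₂⟩ := key 1
  refine ⟨g₁, g₂, ⟨⟨?_, ?_, ?_⟩, ?_⟩, ?_⟩
  · rintro f (rfl | rfl)
    · exact hg₁
    · exact hg₂
  · rintro f (rfl | rfl)
    · exact hne hi₁
    · exact hne hi₂
  · intro f hf hf0
    have hf' := (mem_interpolationModule_iff hg r f).mp hf
    rcases exists_isLeadingMonomial (κ := k - 1) hq hf'.1 hf'.2.1 hf0 with ⟨j, hj⟩ | ⟨j, hj⟩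
    · exact ⟨g₁, by simp, _, _, hi₁, hj, rfl, hmin₁ f hf j hj⟩
    · exact ⟨g₂, by simp, _, _, hi₂, hj, rfl, hmin₂ f hf j hj⟩
  · rintro f (rfl | rfl) h (rfl | rfl) hfh μ ν hμ hν hdvd
    · exact hfh rfl
    · rw [hμ.unique hi₁, hν.unique hi₂] at hdvd
      exact absurd hdvd.1 (by simp)
    · rw [hμ.unique hi₂, hν.unique hi₁] at hdvd
      exact absurd hdvd.1 (by simp)
    · exact hfh rfl
  · have hg₂' := (mem_interpolationModule_iff hg r g₂).mp hg₂
    rw [isLeadingMonomial_one_iff hq hg₂'.1 hg₂'.2.1] at hi₂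
    rw [hi₂.1]
    exact_mod_cast hi₂.2

/-- The two elements of an admissible basis have leading monomials in different positions, and
each is the smallest one that occurs in its position in the module. -/
theorem IsAdmissibleBasis.exists_leadingMonomials {k : ℕ} (hg : LinearIndependent F g)
    {g₁ g₂ : Fin 2 → K[X]} (h : IsAdmissibleBasis (Fintype.card F) k
      (interpolationModule F (Fintype.card F) g r) g₁ g₂) :
    ∃ i₁ i₂ : ℕ, IsLeadingMonomial (Fintype.card F) ![0, k - 1] g₁ (i₁, 0) ∧
      IsLeadingMonomial (Fintype.card F) ![0, k - 1] g₂ (i₂, 1) ∧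
      (∀ f ∈ interpolationModule F (Fintype.card F) g r, ∀ j,
        IsLeadingMonomial (Fintype.card F) ![0, k - 1] f (j, 0) → i₁ ≤ j) ∧
      ∀ f ∈ interpolationModule F (Fintype.card F) g r, ∀ j,
        IsLeadingMonomial (Fintype.card F) ![0, k - 1] f (j, 1) → i₂ ≤ j := by
  have hq : 1 < Fintype.card F := Fintype.one_lt_card
  obtain ⟨⟨⟨hsub, hne, hdiv⟩, -⟩, hdeg⟩ := h
  have hdiv' : ∀ f ∈ interpolationModule F (Fintype.card F) g r, ∀ ν,
      IsLeadingMonomial (Fintype.card F) ![0, k - 1] f ν → ∃ h ∈ ({g₁, g₂} : Set (Fin 2 → K[X])),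
        ∃ μ, IsLeadingMonomial (Fintype.card F) ![0, k - 1] h μ ∧ monomialDvd μ ν := by
    intro f hf ν hν
    obtain ⟨h, hh, μ, ν', hμ, hν', hd⟩ := hdiv f hf (by
      rintro rfl
      exact hν.1 (by simp))
    exact ⟨h, hh, μ, hμ, hν'.unique hν ▸ hd⟩
  have hm₂ := (mem_interpolationModule_iff hg r g₂).mp (hsub (by simp))
  -- the condition on `g₂` excludes a leading monomial in the first position
  obtain ⟨i₂, hi₂⟩ : ∃ i₂, IsLeadingMonomial (Fintype.card F) ![0, k - 1] g₂ (i₂, 1) := by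
    refine (exists_isLeadingMonomial hq hm₂.1 hm₂.2.1 (hne g₂ (by simp))).resolve_left ?_
    rintro ⟨i, hi⟩
    rw [isLeadingMonomial_zero_iff hq hm₂.1 hm₂.2.1] at hi
    rw [hi.1] at hdeg
    exact absurd hi.2 (not_lt_of_ge hdeg)
  obtain ⟨i₁, hi₁⟩ : ∃ i₁, IsLeadingMonomial (Fintype.card F) ![0, k - 1] g₁ (i₁, 0) := by
    obtain ⟨f, hf, i, hi⟩ := exists_mem_leadingMonomial_zero hg r (k - 1)
    obtain ⟨h, rfl | rfl, ⟨j, p⟩, hμ, hd⟩ := hdiv' f hf _ hi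
    · obtain rfl : p = 0 := hd.1
      exact ⟨j, hμ⟩
    · rw [hμ.unique hi₂] at hd
      exact absurd hd.1 (by simp)
  refine ⟨i₁, i₂, hi₁, hi₂, fun f hf j hj => ?_, fun f hf j hj => ?_⟩
  · obtain ⟨h, rfl | rfl, μ, hμ, hd⟩ := hdiv' f hf _ hj
    · rw [hμ.unique hi₁] at hd
      exact hd.2
    · rw [hμ.unique hi₂] at hd
      exact absurd hd.1 (by simp)
  · obtain ⟨h, rfl | rfl, μ, hμ, hd⟩ := hdiv' f hf _ hj
    · rw [hμ.unique hi₁] at hd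
      exact absurd hd.1 (by simp)
    · rw [hμ.unique hi₂] at hd
      exact hd.2

/-- Division by the basis: if the leading monomials of `g₁`, `g₂` are the smallest ones of their
positions, then every element of the module is a left combination of `g₁` and `g₂`. -/
theorem exists_eq_compRow_add_compRow {κ : ℕ} (hg : LinearIndependent F g)
    {g₁ g₂ : Fin 2 → K[X]} {i₁ i₂ : ℕ}
    (hg₁ : g₁ ∈ interpolationModule F (Fintype.card F) g r)
    (hg₂ : g₂ ∈ interpolationModule F (Fintype.card F) g r)
    (hi₁ : IsLeadingMonomial (Fintype.card F) ![0, κ] g₁ (i₁, 0))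
    (hi₂ : IsLeadingMonomial (Fintype.card F) ![0, κ] g₂ (i₂, 1))
    (hmin₁ : ∀ f ∈ interpolationModule F (Fintype.card F) g r, ∀ j,
        IsLeadingMonomial (Fintype.card F) ![0, κ] f (j, 0) → i₁ ≤ j)
    (hmin₂ : ∀ f ∈ interpolationModule F (Fintype.card F) g r, ∀ j,
        IsLeadingMonomial (Fintype.card F) ![0, κ] f (j, 1) → i₂ ≤ j)
    {f : Fin 2 → K[X]} (hf : f ∈ interpolationModule F (Fintype.card F) g r) :
    ∃ a b : K[X], IsLinearized (Fintype.card F) a ∧ IsLinearized (Fintype.card F) b ∧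
      f = compRow a g₁ + compRow b g₂ := by
  have hq : 1 < Fintype.card F := Fintype.one_lt_card
  obtain ⟨hl₁0, hl₁1, -⟩ := (mem_interpolationModule_iff hg r g₁).mp hg₁
  obtain ⟨hl₂0, hl₂1, -⟩ := (mem_interpolationModule_iff hg r g₂).mp hg₂
  rw [isLeadingMonomial_zero_iff hq hl₁0 hl₁1] at hi₁
  rw [isLeadingMonomial_one_iff hq hl₂0 hl₂1] at hi₂
  -- the numbers `2 * i` and `2 * (i + κ) + 1` assigned to `(i, 0)` and `(i, 1)` encode the monomial
  -- order, so that subtracting a multiple of `g₁` or `g₂` lowers the bound `N`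
  suffices hN : ∀ N : ℕ, ∀ f ∈ interpolationModule F (Fintype.card F) g r,
      (∀ i, IsLeadingMonomial (Fintype.card F) ![0, κ] f (i, 0) → 2 * i < N) →
      (∀ i, IsLeadingMonomial (Fintype.card F) ![0, κ] f (i, 1) → 2 * (i + κ) + 1 < N) →
      ∃ a b : K[X], IsLinearized (Fintype.card F) a ∧ IsLinearized (Fintype.card F) b ∧
        f = compRow a g₁ + compRow b g₂ by
    by_cases hf0 : f = 0
    · exact hN 0 f hf (fun i hi => absurd hi.1 (by simp [hf0]))
        (fun i hi => absurd hi.1 (by simp [hf0]))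
    · have hf' := (mem_interpolationModule_iff hg r f).mp hf
      rcases exists_isLeadingMonomial (κ := κ) hq hf'.1 hf'.2.1 hf0 with ⟨j, hj⟩ | ⟨j, hj⟩
      · exact hN (2 * j + 1) f hf (fun i hi => by cases hi.unique hj; omega)
          (fun i hi => by cases hi.unique hj)
      · exact hN (2 * (j + κ) + 2) f hf (fun i hi => by cases hi.unique hj)
          (fun i hi => by cases hi.unique hj; omega)
  intro N
  induction N with
  | zero =>
    intro f hf h0 h1
    have hf' := (mem_interpolationModule_iff hg r f).mp hf
    have hf0 : f = 0 := by
      by_contra hne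
      rcases exists_isLeadingMonomial (κ := κ) hq hf'.1 hf'.2.1 hne with ⟨j, hj⟩ | ⟨j, hj⟩
      · exact absurd (h0 j hj) (by omega)
      · exact absurd (h1 j hj) (by omega)
    exact ⟨0, 0, isLinearized_zero, isLinearized_zero, by funext p; simp [hf0, compRow]⟩
  | succ N ih =>
    intro f hf h0 h1
    obtain ⟨hf0, hf1, -⟩ := (mem_interpolationModule_iff hg r f).mp hf
    by_cases hfz : f = 0
    · exact ⟨0, 0, isLinearized_zero, isLinearized_zero, by funext p; simp [hfz, compRow]⟩
    rcases exists_isLeadingMonomial (κ := κ) hq hf0 hf1 hfz with ⟨i, hi⟩ | ⟨i, hi⟩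
    · have hle := hmin₁ f hf i hi
      have hlt := h0 i hi
      rw [isLeadingMonomial_zero_iff hq hf0 hf1] at hi
      obtain ⟨c, hc, hcd, hcl⟩ := hf0.exists_cancel_leading hl₁0
        (hl₁0.natDegree_of_qdeg hq hi₁.1).1 (hf0.natDegree_of_qdeg hq hi.1).1
        (by rw [hi₁.1, hi.1]; exact_mod_cast hle)
      have hmem := sub_compRow_mem_interpolationModule hg hc hf hg₁
      have hm' := (mem_interpolationModule_iff hg r _).mp hmem
      have hb : qdeg (Fintype.card F) ((f - compRow c g₁) 1) + (κ : WithBot ℕ) < i := by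
        have h2 : qdeg (Fintype.card F) ((f - compRow c g₁) 1) ≤ _ :=
          (congrArg (qdeg _) (sub_eq_add_neg (f 1) (c.comp (g₁ 1)))).le.trans (qdeg_add_le _ _)
        rw [qdeg_neg, qdeg_comp hq hc hl₁1] at h2
        refine (add_le_add_left h2 _).trans_lt ?_
        rw [max_add, max_lt_iff]
        refine ⟨hi.2, ?_⟩
        rw [hi₁.1, hi.1] at hcd
        have h3 := hi₁.2
        generalize qdeg (Fintype.card F) c = x at hcd
        generalize qdeg (Fintype.card F) (g₁ 1) = y at h3
        rw [← hcd, add_assoc]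
        cases x with
        | bot => simp at hcd
        | coe x => exact WithBot.add_lt_add_left (by simp) h3
      obtain ⟨a, b, ha, hb', hab⟩ := ih _ hmem (fun j hj => by
          rw [isLeadingMonomial_zero_iff hq hm'.1 hm'.2.1] at hj
          have h2 : qdeg (Fintype.card F) ((f - compRow c g₁) 0) < _ := hcl
          rw [hj.1, hi.1] at h2
          have : j < i := by exact_mod_cast h2
          omega) (fun j hj => by
          rw [isLeadingMonomial_one_iff hq hm'.1 hm'.2.1] at hj
          rw [hj.1] at hb
          have : j + κ < i := by exact_mod_cast hb
          omega)
      refine ⟨a + c, b, ha.add hc, hb', ?_⟩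
      rw [sub_eq_iff_eq_add] at hab
      rw [hab]
      funext p
      simp only [compRow, Pi.add_apply, add_comp]
      ring
    · have hle := hmin₂ f hf i hi
      have hlt := h1 i hi
      rw [isLeadingMonomial_one_iff hq hf0 hf1] at hi
      obtain ⟨c, hc, hcd, hcl⟩ := hf1.exists_cancel_leading hl₂1
        (hl₂1.natDegree_of_qdeg hq hi₂.1).1 (hf1.natDegree_of_qdeg hq hi.1).1
        (by rw [hi₂.1, hi.1]; exact_mod_cast hle)
      have hmem := sub_compRow_mem_interpolationModule hg hc hf hg₂
      have hm' := (mem_interpolationModule_iff hg r _).mp hmem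
      have hb : qdeg (Fintype.card F) ((f - compRow c g₂) 0) ≤ ((i + κ : ℕ) : WithBot ℕ) := by
        have h2 : qdeg (Fintype.card F) ((f - compRow c g₂) 0) ≤ _ :=
          (congrArg (qdeg _) (sub_eq_add_neg (f 0) (c.comp (g₂ 0)))).le.trans (qdeg_add_le _ _)
        rw [qdeg_neg, qdeg_comp hq hc hl₂0] at h2
        refine h2.trans (max_le hi.2 ?_)
        rw [hi₂.1, hi.1] at hcd
        refine (add_le_add_right hi₂.2 _).trans ?_
        rw [Nat.cast_add, Nat.cast_add, ← add_assoc]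
        exact add_le_add_left hcd.le _
      obtain ⟨a, b, ha, hb', hab⟩ := ih _ hmem (fun j hj => by
          rw [isLeadingMonomial_zero_iff hq hm'.1 hm'.2.1] at hj
          rw [hj.1] at hb
          have : j ≤ i + κ := by exact_mod_cast hb
          omega) (fun j hj => by
          rw [isLeadingMonomial_one_iff hq hm'.1 hm'.2.1] at hj
          have h2 : qdeg (Fintype.card F) ((f - compRow c g₂) 1) < _ := hcl
          rw [hj.1, hi.1] at h2
          have : j < i := by exact_mod_cast h2
          omega)
      refine ⟨a, b + c, ha, hb'.add hc, ?_⟩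
      rw [sub_eq_iff_eq_add] at hab
      rw [hab]
      funext p
      simp only [compRow, Pi.add_apply, add_comp]
      ring

end Basis

theorem eq_bot_or_exists_natCast (x : WithBot ℕ) : x = ⊥ ∨ ∃ i : ℕ, x = i := by
  cases x with
  | bot => exact Or.inl rfl
  | coe x => exact Or.inr ⟨x, rfl⟩

section Combination

variable {K : Type*} [Field K] {q κ i₁ i₂ : ℕ} {g₁ g₂ : Fin 2 → K[X]} {a b : K[X]}

/-- If the leading monomial of `a ∘ g₁` is below that of `b ∘ g₂`, then the combination
`a ∘ g₁ + b ∘ g₂` has its leading monomial in the second position. -/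
theorem qdeg_combination_of_le (hq : 1 < q) (hl₁0 : IsLinearized q (g₁ 0))
    (hl₁1 : IsLinearized q (g₁ 1)) (hl₂0 : IsLinearized q (g₂ 0))
    (hl₂1 : IsLinearized q (g₂ 1))
    (h₁0 : qdeg q (g₁ 0) = i₁)
    (h₁1 : qdeg q (g₁ 1) + (κ : WithBot ℕ) < i₁)
    (h₂0 : qdeg q (g₂ 0) ≤ ((i₂ + κ : ℕ) : WithBot ℕ))
    (h₂1 : qdeg q (g₂ 1) = i₂)
    (ha : IsLinearized q a) (hb : IsLinearized q b) {j : ℕ}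
    (hj : qdeg q b = j)
    (hle : qdeg q a + (i₁ : WithBot ℕ) ≤ ((j + i₂ + κ : ℕ) : WithBot ℕ)) :
    qdeg q ((compRow a g₁ + compRow b g₂) 1) = ((j + i₂ : ℕ) : WithBot ℕ) ∧
      qdeg q ((compRow a g₁ + compRow b g₂) 0) ≤
        ((j + i₂ + κ : ℕ) : WithBot ℕ) := by
  simp only [compRow, Pi.add_apply]
  constructor
  · rw [qdeg_add_eq_right] <;> rw [qdeg_comp hq hb hl₂1, h₂1, hj]
    · norm_cast
    · rw [qdeg_comp hq ha hl₁1]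
      generalize qdeg q a = x at hle
      generalize qdeg q (g₁ 1) = y at h₁1
      obtain rfl | ⟨x, rfl⟩ := eq_bot_or_exists_natCast x
      · rw [WithBot.bot_add]; exact WithBot.bot_lt_coe _
      obtain rfl | ⟨y, rfl⟩ := eq_bot_or_exists_natCast y
      · rw [WithBot.add_bot]; exact WithBot.bot_lt_coe _
      have h1 : x + i₁ ≤ j + i₂ + κ := by exact_mod_cast hle
      have h2 : y + κ < i₁ := by exact_mod_cast h₁1
      have h3 : x + y < j + i₂ := by omega
      exact_mod_cast h3
  · refine (qdeg_add_le _ _).trans (max_le ?_ ?_)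
    · rw [qdeg_comp hq ha hl₁0, h₁0]
      exact hle
    · rw [qdeg_comp hq hb hl₂0, hj]
      refine (add_le_add_right h₂0 _).trans ?_
      rw [add_assoc]
      norm_cast

/-- If the leading monomial of `a ∘ g₁` is above that of `b ∘ g₂`, then the combination
`a ∘ g₁ + b ∘ g₂` has its leading monomial in the first position. -/
theorem qdeg_combination_of_lt (hq : 1 < q) (hl₁0 : IsLinearized q (g₁ 0))
    (hl₁1 : IsLinearized q (g₁ 1)) (hl₂0 : IsLinearized q (g₂ 0))
    (hl₂1 : IsLinearized q (g₂ 1))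
    (h₁0 : qdeg q (g₁ 0) = i₁)
    (h₁1 : qdeg q (g₁ 1) + (κ : WithBot ℕ) < i₁)
    (h₂0 : qdeg q (g₂ 0) ≤ ((i₂ + κ : ℕ) : WithBot ℕ))
    (h₂1 : qdeg q (g₂ 1) = i₂)
    (ha : IsLinearized q a) (hb : IsLinearized q b)
    (hlt : qdeg q b + ((i₂ + κ : ℕ) : WithBot ℕ) <
      qdeg q a + (i₁ : WithBot ℕ)) :
    qdeg q ((compRow a g₁ + compRow b g₂) 1) + (κ : WithBot ℕ) <
      qdeg q ((compRow a g₁ + compRow b g₂) 0) := by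
  simp only [compRow, Pi.add_apply]
  have h0 : qdeg q (a.comp (g₁ 0) + b.comp (g₂ 0)) =
      qdeg q a + (i₁ : WithBot ℕ) := by
    rw [qdeg_add_eq_left] <;> rw [qdeg_comp hq ha hl₁0, h₁0]
    rw [qdeg_comp hq hb hl₂0]
    exact (add_le_add_right h₂0 _).trans_lt hlt
  rw [h0]
  refine (add_le_add_left (qdeg_add_le _ _) _).trans_lt ?_
  rw [max_add, max_lt_iff, qdeg_comp hq ha hl₁1, qdeg_comp hq hb hl₂1, h₂1]
  constructor
  · generalize qdeg q a = x at hlt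
    rw [add_assoc]
    cases x with
    | bot => rw [WithBot.bot_add] at hlt; exact absurd hlt not_lt_bot
    | coe x => exact WithBot.add_lt_add_left (by simp) h₁1
  · rw [add_assoc]
    exact_mod_cast hlt

end Combination

/-! ### Rank distance and the code -/

theorem rankDist_eq_finrank_span {F K : Type*} [Field F] [Field K] [Algebra F K]
    {m n : ℕ} (β : Module.Basis (Fin m) F K) (u v : Fin n → K) :
    rankDist β u v = Module.finrank F (Submodule.span F (Set.range (u - v))) := by
  rw [rankDist, Matrix.rank_eq_finrank_span_cols]
  have : Set.range (β.toMatrix (u - v)).col = β.equivFun '' Set.range (u - v) := by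
    rw [← Set.range_comp]
    rfl
  rw [this, ← LinearEquiv.coe_coe, Submodule.span_image]
  exact LinearEquiv.finrank_map_eq β.equivFun _

theorem encode_ofCoeffs {K : Type*} [Field K] (q : ℕ) {n k : ℕ} (g : Fin n → K) (c : Fin k → K) :
    encode g (ofCoeffs q c) = ∑ i : Fin k, c i • mooreMatrix q k g i := by
  funext j
  simp [encode, ofCoeffs, eval_finsetSum, mooreMatrix]

/-- The codewords are the words of the message polynomials. -/
theorem mem_gabidulinCode_iff {K : Type*} [Field K] {q n k : ℕ} (hq : 1 < q)
    (g : Fin n → K) (c : Fin n → K) :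
    c ∈ gabidulinCode q k g ↔
      ∃ f : K[X], IsLinearized q f ∧ qdeg q f < (k : WithBot ℕ) ∧ encode g f = c := by
  rw [gabidulinCode, Submodule.mem_span_range_iff_exists_fun]
  constructor
  · rintro ⟨a, rfl⟩
    exact ⟨_, isLinearized_ofCoeffs q a, qdeg_ofCoeffs_lt hq a, encode_ofCoeffs q g a⟩
  · rintro ⟨f, hf, hfd, rfl⟩
    refine ⟨fun i => f.coeff (q ^ (i : ℕ)), ?_⟩
    rw [← encode_ofCoeffs, ← hf.eq_ofCoeffs hq hfd]

section RankDistance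

variable {F K : Type*} [Field F] [Fintype F] [Field K] [Fintype K] [Algebra F K]
variable {m n k : ℕ}

/-- Two words have rank distance at most `d` exactly if some linearized polynomial of `q`-degree
exactly `d` vanishes on the coordinates of their difference: the annihilator of the span of the
coordinates can be composed with a power `x^[i]` to raise its `q`-degree. -/
theorem rankDist_le_iff (β : Module.Basis (Fin m) F K) (u v : Fin n → K) (d : ℕ) :
    rankDist β u v ≤ d ↔ ∃ D : K[X], IsLinearized (Fintype.card F) D ∧
      qdeg (Fintype.card F) D = d ∧ ∀ i, D.eval (u i - v i) = 0 := by
  have hq : 1 < Fintype.card F := Fintype.one_lt_card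
  rw [rankDist_eq_finrank_span]
  constructor
  · intro h
    obtain ⟨P, hP, -, hPd, hPV⟩ :=
      exists_monic_vanishing (F := F) (Submodule.span F (Set.range (u - v)))
    refine ⟨_, (isLinearized_X_pow (d - Module.finrank F
      (Submodule.span F (Set.range (u - v))))).comp hP, ?_, fun i => ?_⟩
    · rw [qdeg_comp hq (isLinearized_X_pow _) hP, qdeg_X_pow hq, hPd]
      exact_mod_cast Nat.sub_add_cancel h
    · have := hPV (u i - v i) (Submodule.subset_span ⟨i, rfl⟩)
      simp [this]
  · rintro ⟨D, hD, hDd, hDV⟩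
    by_contra hlt
    refine (hD.natDegree_of_qdeg hq hDd).1 (hD.eq_zero_of_vanishes
      (Submodule.span F (Set.range (u - v))) (fun x hx => ?_) ?_)
    · exact hD.eval_eq_zero_of_mem_span (by rintro _ ⟨i, rfl⟩; exact hDV i) hx
    · rw [hDd]
      exact_mod_cast not_le.mp hlt

end RankDistance

/-! ### The list decoding algorithm -/

theorem mem_listOf {α : Type*} {S : Set α} (hS : S.Finite) {x : α} : x ∈ listOf S ↔ x ∈ S := by
  rw [listOf, dif_pos hS, Finset.mem_toList, Set.Finite.mem_toFinset]

/-- As long as the stages find nothing, the loop only counts. -/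
theorem iterate_loopStep {K : Type*} [Field K] {q : ℕ} {w : Fin 2 → ℕ}
    {g₁ g₂ : Fin 2 → K[X]} {J : ℕ}
    (h : ∀ j < J, stageList q w g₁ g₂ j = []) :
    (loopStep q w g₁ g₂)^[J] ([], 0) = ([], J) := by
  induction J with
  | zero => rfl
  | succ J ih =>
    rw [Function.iterate_succ_apply', ih fun j hj => h j (by omega)]
    simp [loopStep, h J (by omega)]

/-- Left cancellation makes the symbolic quotient unique, so that the chosen quotient is the only
one. -/
theorem symbolicQuotient_eq_some_iff {F K : Type*} [Field F] [Fintype F] [Field K]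
    [Algebra F K] {N D s : K[X]} (hD : IsLinearized (Fintype.card F) D)
    (hD0 : D ≠ 0) : symbolicQuotient (Fintype.card F) N D = some s ↔
      IsLinearized (Fintype.card F) s ∧ D.comp s = N := by
  unfold symbolicQuotient
  constructor
  · intro h
    split_ifs at h with hex
    cases h
    exact hex.choose_spec
  · rintro ⟨hs, hsN⟩
    have hex : ∃ s : K[X], IsLinearized (Fintype.card F) s ∧ D.comp s = N := ⟨s, hs, hsN⟩
    rw [dif_pos hex]
    exact congrArg some (hD.comp_left_cancel hD0 hex.choose_spec.1 hs
      (hex.choose_spec.2.trans hsN.symm))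

section Algorithm

variable {F K : Type*} [Field F] [Fintype F] [Field K] [Fintype K] [Algebra F K]
variable {m n k : ℕ}

theorem comp_mem_interpolationModule {g : Fin n → K} (hg : LinearIndependent F g) {r : Fin n → K}
    {D s : K[X]} (hD : IsLinearized (Fintype.card F) D) (hs : IsLinearized (Fintype.card F) s)
    (h : ∀ i, D.eval (encode g s i - r i) = 0) :
    ![D.comp s, -D] ∈ interpolationModule F (Fintype.card F) g r := by
  refine (mem_interpolationModule_iff hg r _).mpr ⟨hD.comp hs, hD.neg, fun i => ?_⟩
  obtain ⟨φ, hφ⟩ := hD.exists_evalMap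
  have h' := h i
  rw [← hφ, map_sub, hφ, hφ, encode] at h'
  simpa [sub_eq_add_neg] using h'

/-- For `D` of `q`-degree equal to the distance, `[D ∘ s  -D]` is in the module and has leading
monomial `x^[qdeg D]` in the second position, so the distance is bounded below by `i₂`. -/
theorem le_rankDist_encode (hk : 1 ≤ k) (β : Module.Basis (Fin m) F K) {g : Fin n → K}
    (hg : LinearIndependent F g) {r : Fin n → K} {i₂ : ℕ}
    (hmin₂ : ∀ f ∈ interpolationModule F (Fintype.card F) g r, ∀ j,
        IsLeadingMonomial (Fintype.card F) ![0, k - 1] f (j, 1) → i₂ ≤ j)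
    {s : K[X]} (hs : IsLinearized (Fintype.card F) s)
    (hsd : qdeg (Fintype.card F) s < (k : WithBot ℕ)) :
    i₂ ≤ rankDist β (encode g s) r := by
  have hq : 1 < Fintype.card F := Fintype.one_lt_card
  obtain ⟨D, hD, hDd, hDr⟩ := (rankDist_le_iff β (encode g s) r _).mp le_rfl
  refine hmin₂ _ (comp_mem_interpolationModule hg hD hs hDr) _
    ((isLeadingMonomial_one_iff hq (hD.comp hs) hD.neg).mpr ⟨(qdeg_neg D).trans hDd, ?_⟩)
  rw [Matrix.cons_val_zero, qdeg_comp hq hD hs, hDd]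
  generalize qdeg (Fintype.card F) s = x at hsd
  obtain rfl | ⟨x, rfl⟩ := eq_bot_or_exists_natCast x
  · simp
  · have h1 : x < k := by exact_mod_cast hsd
    have h2 : x ≤ k - 1 := by omega
    exact_mod_cast Nat.add_le_add_left h2 _

/-- The quotients found in stage `j` are the message polynomials at rank distance at most
`i₂ + j`, where `i₂` is the `q`-degree of `g₂^(2)`; by `rankDist_le_iff` they correspond to the
elements `[D ∘ s  -D]` of the module with `D` of `q`-degree `i₂ + j`, and these are the elements
whose leading monomial is `x^[i₂ + j]` in the second position. -/
theorem mem_stageList_iff (hk : 1 ≤ k) (β : Module.Basis (Fin m) F K) {g : Fin n → K}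
    (hg : LinearIndependent F g) {r : Fin n → K} {g₁ g₂ : Fin 2 → K[X]} {i₁ i₂ : ℕ}
    (hg₁ : g₁ ∈ interpolationModule F (Fintype.card F) g r)
    (hg₂ : g₂ ∈ interpolationModule F (Fintype.card F) g r)
    (hi₁ : IsLeadingMonomial (Fintype.card F) ![0, k - 1] g₁ (i₁, 0))
    (hi₂ : IsLeadingMonomial (Fintype.card F) ![0, k - 1] g₂ (i₂, 1))
    (hmin₁ : ∀ f ∈ interpolationModule F (Fintype.card F) g r, ∀ j,
        IsLeadingMonomial (Fintype.card F) ![0, k - 1] f (j, 0) → i₁ ≤ j)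
    (hmin₂ : ∀ f ∈ interpolationModule F (Fintype.card F) g r, ∀ j,
        IsLeadingMonomial (Fintype.card F) ![0, k - 1] f (j, 1) → i₂ ≤ j)
    (j : ℕ) (s : K[X]) :
    s ∈ stageList (Fintype.card F) ![0, k - 1] g₁ g₂ j ↔
      IsLinearized (Fintype.card F) s ∧ qdeg (Fintype.card F) s < (k : WithBot ℕ) ∧
        rankDist β (encode g s) r ≤ i₂ + j := by
  have hq : 1 < Fintype.card F := Fintype.one_lt_card
  obtain ⟨hl₁0, hl₁1, -⟩ := (mem_interpolationModule_iff hg r g₁).mp hg₁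
  obtain ⟨hl₂0, hl₂1, -⟩ := (mem_interpolationModule_iff hg r g₂).mp hg₂
  obtain ⟨h₁0, h₁1⟩ := (isLeadingMonomial_zero_iff hq hl₁0 hl₁1).mp hi₁
  obtain ⟨h₂1, h₂0⟩ := (isLeadingMonomial_one_iff hq hl₂0 hl₂1).mp hi₂
  have hw₁ : weightedDeg (Fintype.card F) ![0, k - 1] g₁ = i₁ := by
    have : (((k - 1 : ℕ) : WithBot ℕ)) + qdeg (Fintype.card F) (g₁ 1) ≤ i₁ := by
      rw [add_comm]; exact h₁1.le
    simpa [weightedDeg, h₁0] using this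
  have hw₂ : weightedDeg (Fintype.card F) ![0, k - 1] g₂ = ((i₂ + (k - 1) : ℕ) : WithBot ℕ) := by
    have h := h₂0
    simp only [weightedDeg, Matrix.cons_val_zero, Matrix.cons_val_one, h₂1]
    rw [max_eq_right]
    · rw [add_comm]; norm_cast
    · rw [Nat.cast_zero, zero_add, add_comm ((k - 1 : ℕ) : WithBot ℕ)]
      exact_mod_cast h
  have hfin₁ := finite_outerRange (K := K) hq (ℓ₁ := (i₁ : WithBot ℕ)) (WithBot.coe_ne_bot)
    ((i₂ + (k - 1) : ℕ) : WithBot ℕ) j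
  have hfin₂ := finite_innerRange (K := K) hq j
  have hcalc : ((i₂ + (k - 1) : ℕ) : WithBot ℕ) + (j : WithBot ℕ) =
      ((j + i₂ + (k - 1) : ℕ) : WithBot ℕ) := by
    rw [← Nat.cast_add]; congr 1; omega
  have hk' : ∀ x : WithBot ℕ, ((i₂ + j : ℕ) : WithBot ℕ) + x ≤
      ((j + i₂ + (k - 1) : ℕ) : WithBot ℕ) ↔ x < (k : WithBot ℕ) := by
    intro x
    obtain rfl | ⟨x, rfl⟩ := eq_bot_or_exists_natCast x
    · simp
    · have : i₂ + j + x ≤ j + i₂ + (k - 1) ↔ x < k := by omega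
      exact_mod_cast this
  have hji : ((j + i₂ : ℕ) : WithBot ℕ) = ((i₂ + j : ℕ) : WithBot ℕ) := by rw [add_comm]
  rw [stageList, hw₁, hw₂, rankDist_le_iff]
  simp only [List.mem_flatMap, List.mem_filterMap, mem_listOf hfin₁, mem_listOf hfin₂]
  constructor
  · rintro ⟨a, ⟨ha, had⟩, b, ⟨hb, hbm, hbd⟩, hs⟩
    rw [hcalc] at had
    obtain ⟨hf1, hf0⟩ := qdeg_combination_of_le hq hl₁0 hl₁1 hl₂0 hl₂1 h₁0 h₁1 h₂0 h₂1 ha hb hbd had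
    obtain ⟨hm0, hm1, hmr⟩ := (mem_interpolationModule_iff hg r _).mp
      (add_mem_interpolationModule hg (compRow_mem_interpolationModule hg ha hg₁)
        (compRow_mem_interpolationModule hg hb hg₂))
    set f := compRow a g₁ + compRow b g₂
    have hD : IsLinearized (Fintype.card F) (-f 1) := hm1.neg
    have hDd : qdeg (Fintype.card F) (-f 1) = ((i₂ + j : ℕ) : WithBot ℕ) := by
      rw [qdeg_neg, hf1, hji]
    obtain ⟨hsl, hsc⟩ := (symbolicQuotient_eq_some_iff hD
      (hD.natDegree_of_qdeg hq hDd).1).mp hs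
    refine ⟨hsl, ?_, -f 1, hD, hDd, fun i => ?_⟩
    · rw [← hsc, qdeg_comp hq hD hsl, hDd] at hf0
      exact (hk' _).mp hf0
    · have h := hmr i
      obtain ⟨φ, hφ⟩ := hD.exists_evalMap
      rw [← hφ, map_sub, hφ, hφ, encode, ← eval_comp, hsc, eval_neg]
      linear_combination h
  · rintro ⟨hs, hsd, D, hD, hDd, hDr⟩
    have hmem := comp_mem_interpolationModule hg hD hs hDr
    obtain ⟨a, b, ha, hb, hab⟩ :=
      exists_eq_compRow_add_compRow hg hg₁ hg₂ hi₁ hi₂ hmin₁ hmin₂ hmem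
    have e0 : D.comp s = (compRow a g₁ + compRow b g₂) 0 := congrFun hab 0
    have e1 : -D = (compRow a g₁ + compRow b g₂) 1 := congrFun hab 1
    have hsum : qdeg (Fintype.card F) (D.comp s) ≤ ((j + i₂ + (k - 1) : ℕ) : WithBot ℕ) := by
      rw [qdeg_comp hq hD hs, hDd]
      exact (hk' _).mpr hsd
    -- otherwise the leading monomial would be in the first position
    have hle : qdeg (Fintype.card F) a + (i₁ : WithBot ℕ) ≤
        qdeg (Fintype.card F) b + ((i₂ + (k - 1) : ℕ) : WithBot ℕ) := by
      by_contra hlt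
      have := qdeg_combination_of_lt hq hl₁0 hl₁1 hl₂0 hl₂1 h₁0 h₁1 h₂0 h₂1 ha hb (not_le.mp hlt)
      rw [← e0, ← e1, qdeg_neg, hDd] at this
      refine absurd (this.trans_le hsum) ?_
      rw [← hji, ← Nat.cast_add]
      exact lt_irrefl _
    have hb0 : b ≠ 0 := by
      rintro rfl
      rw [qdeg_zero, WithBot.bot_add, le_bot_iff, WithBot.add_eq_bot, qdeg_eq_bot] at hle
      have ha0 : a = 0 := hle.resolve_right (WithBot.coe_ne_bot)
      rw [ha0] at e1
      refine (hD.natDegree_of_qdeg hq hDd).1 (neg_eq_zero.mp (e1.trans ?_))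
      simp [compRow]
    obtain ⟨e, he, -⟩ := hb.exists_natDegree hq hb0
    have hej : e = j := by
      have hle' := hle
      rw [he, ← Nat.cast_add, ← add_assoc] at hle'
      have := (qdeg_combination_of_le hq hl₁0 hl₁1 hl₂0 hl₂1 h₁0 h₁1 h₂0 h₂1 ha hb he hle').1
      rw [← e1, qdeg_neg, hDd] at this
      have h3 : i₂ + j = e + i₂ := by exact_mod_cast this
      omega
    subst hej
    -- a scalar factor on the left makes `b` monic and does not change the quotient
    set c := b.leadingCoeff⁻¹ with hc
    have hc0 : c ≠ 0 := inv_ne_zero (leadingCoeff_ne_zero.mpr hb0)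
    have hscale : compRow (C c * a) g₁ + compRow (C c * b) g₂ =
        fun p => C c * (compRow a g₁ + compRow b g₂) p := by
      funext p; simp [compRow, mul_add]
    refine ⟨C c * a, ⟨ha.C_mul c, ?_⟩, C c * b, ⟨hb.C_mul c, ?_, ?_⟩, ?_⟩
    · rw [qdeg_C_mul hc0, hcalc]
      rw [he, ← Nat.cast_add, ← add_assoc] at hle
      exact hle
    · rw [Monic, leadingCoeff_mul, leadingCoeff_C, hc,
        inv_mul_cancel₀ (leadingCoeff_ne_zero.mpr hb0)]
    · rw [qdeg_C_mul hc0, he]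
    · rw [hscale]
      simp only [← e0, ← e1]
      have hneg : -(C c * -D) = C c * D := by ring
      rw [hneg, symbolicQuotient_eq_some_iff (hD.C_mul c)
        (mul_ne_zero (C_ne_zero.mpr hc0) (hD.natDegree_of_qdeg hq hDd).1)]
      exact ⟨hs, by rw [mul_comp, C_comp]⟩

end Algorithm
end RankList

open RankList in
theorem mainTheorem4 {F K : Type*} [Field F] [Fintype F] [Field K] [Fintype K] [Algebra F K]
    {m n k : ℕ} (hk : 1 ≤ k) (β : Module.Basis (Fin m) F K)
    (g : Fin n → K) (hg : LinearIndependent F g) (r : Fin n → K) :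
    (∃ g₁ g₂ : Fin 2 → Polynomial K,
      RankList.IsAdmissibleBasis (Fintype.card F) k
        (RankList.interpolationModule F (Fintype.card F) g r) g₁ g₂) ∧
    ∀ g₁ g₂ : Fin 2 → Polynomial K,
      RankList.IsAdmissibleBasis (Fintype.card F) k
        (RankList.interpolationModule F (Fintype.card F) g r) g₁ g₂ →
      ∃ out : List (Polynomial K),
        RankList.Returns (Fintype.card F) k g₁ g₂ out ∧
        ∀ f : Polynomial K,
          f ∈ out ↔ RankList.IsClosestMessage (Fintype.card F) k β g r f := by
  have hq : 1 < Fintype.card F := Fintype.one_lt_card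
  refine ⟨exists_isAdmissibleBasis k hg r, fun g₁ g₂ hadm => ?_⟩
  obtain ⟨i₁, i₂, hi₁, hi₂, hmin₁, hmin₂⟩ := hadm.exists_leadingMonomials hg
  have hstage := mem_stageList_iff hk β hg (hadm.1.1.1 (by simp)) (hadm.1.1.1 (by simp)) hi₁ hi₂
    hmin₁ hmin₂
  -- the zero polynomial is a message, so that the list is nonempty at the latest at its distance
  have hex : ∃ j, stageList (Fintype.card F) ![0, k - 1] g₁ g₂ j ≠ [] :=
    ⟨rankDist β (encode g 0) r, List.ne_nil_of_mem (a := 0) ((hstage _ _).mpr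
      ⟨isLinearized_zero, by rw [qdeg_zero]; exact WithBot.bot_lt_coe _, Nat.le_add_left _ _⟩)⟩
  classical
  obtain ⟨hJ, hJmin⟩ := (Nat.find_eq_iff hex).mp rfl
  set J := Nat.find hex
  -- no message polynomial is closer to `r` than `i₂ + J`
  have hlow : ∀ s, IsLinearized (Fintype.card F) s → qdeg (Fintype.card F) s < (k : WithBot ℕ) →
      i₂ + J ≤ rankDist β (encode g s) r := by
    intro s hs hsd
    by_contra hlt
    have hi₂s := le_rankDist_encode hk β hg hmin₂ hs hsd
    refine hJmin (rankDist β (encode g s) r - i₂) (by omega) (List.ne_nil_of_mem (a := s) ?_)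
    exact (hstage _ _).mpr ⟨hs, hsd, by omega⟩
  refine ⟨stageList (Fintype.card F) ![0, k - 1] g₁ g₂ J, ⟨hJ, J + 1, ?_⟩, fun f => ?_⟩
  · rw [Function.iterate_succ_apply', iterate_loopStep fun j hj => by simpa using hJmin j hj]
    rfl
  · obtain ⟨s, hs⟩ := List.exists_mem_of_ne_nil _ hJ
    rw [hstage] at hs ⊢
    constructor
    · rintro ⟨hf, hfd, hfr⟩
      refine ⟨hf, hfd, fun c hc => ?_⟩
      obtain ⟨h, hh, hhd, rfl⟩ := (mem_gabidulinCode_iff hq g c).mp hc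
      exact hfr.trans (hlow h hh hhd)
    · rintro ⟨hf, hfd, hfr⟩
      exact ⟨hf, hfd, (hfr _ ((mem_gabidulinCode_iff hq g _).mpr ⟨s, hs.1, hs.2.1, rfl⟩)).trans
        hs.2.2⟩
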